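/- **Theorem 2.1.** Let $G$ be a finite simple plane triangulation (a connected plane graph in which every face, including the outer one, is bounded by a triangle) all of whose vertices have even degree. Let $V_1, V_2, V_3$ be the colour classes of a proper $3$-colouring of $V(G)$, and for $i = 1,2,3$ let $B_i$ be the set of all vertices in $V_i$ of degree at least $6$ in $G$. Suppose that the induced subgraphs $G[B_1 \cup B_2]$ and $G[B_1 \cup B_3]$ are acyclic. Then: (a) For every path $abc$ in $G$ (that is, distinct vertices $a,b,c$ with $ab, bc \in E(G)$) there is a partition of $V(G)$ into two sets, each of which induces a tree in $G$, such that one of these trees contains the edge $ab$ and avoids the vertex $c$. (b) For every path $abc$ in $G$ whose end vertices $a$ and $c$ have the same colour there is a partition of $V(G)$ into two sets, each of which induces a tree in $G$, such that one of these trees contains the whole path $abc$. -/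

import Mathlib

/-- An embedding scheme (rotation system) of a simple graph `G` in a closed oriented surface: at every
vertex `v`, `rot` cyclically permutes the darts (directed edges) with tail `v`, in the order in
which they leave `v`. -/
structure RotationSystem {V : Type*} (G : SimpleGraph V) where
  /-- the next dart around the same tail vertex -/
  rot : Equiv.Perm G.Dart
  fst_rot : ∀ d : G.Dart, (rot d).fst = d.fst
  sameCycle_of_fst_eq : ∀ d e : G.Dart, d.fst = e.fst → rot.SameCycle d e

namespace RotationSystem

variable {V : Type*} {G : SimpleGraph V}

/-- The permutation of the darts whose orbits are the boundary walks of the faces: run along a dart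
`u → v`, then leave `v` along the dart that follows `v → u` in the rotation at `v`. -/
def facePerm (R : RotationSystem G) : Equiv.Perm G.Dart :=
  (Function.Involutive.toPerm SimpleGraph.Dart.symm SimpleGraph.Dart.symm_involutive).trans R.rot

/-- The faces of the embedding: the orbits of `facePerm` on the darts. -/
def Face (R : RotationSystem G) : Type _ :=
  Quotient (Equiv.Perm.SameCycle.setoid R.facePerm)

/-- The embedding is an embedding in the plane (equivalently the sphere) of a connected finite
graph: the surface has genus zero, that is, `|V| - |E| + |F| = 2`. -/
def IsPlane (R : RotationSystem G) : Prop :=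
  G.Connected ∧ Nat.card V + Nat.card R.Face = Nat.card G.edgeSet + 2

/-- A plane triangulation: a plane embedding each of whose faces (the outer face included) is bounded
by a triangle. As `G` has no loops, `facePerm` has no fixed point, so the condition below says that
each orbit of `facePerm` consists of exactly three darts, which form a triangle of `G`. -/
def IsPlaneTriangulation (R : RotationSystem G) : Prop :=
  R.IsPlane ∧ ∀ d : G.Dart, R.facePerm (R.facePerm (R.facePerm d)) = d

end RotationSystem

/-- The set of all vertices of colour `i` that are big, that is, of degree at least `6`. -/
def bigVertices {V : Type*} [Fintype V] {G : SimpleGraph V} [DecidableRel G.Adj]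
    (C : G.Coloring (Fin 3)) (i : Fin 3) : Set V :=
  {v | C v = i ∧ 6 ≤ G.degree v}

/-- `V(G)` is partitioned into the two sets `S` and `T`, each of which induces a tree. -/
def IsTreePartition {V : Type*} (G : SimpleGraph V) (S T : Set V) : Prop :=
  S ∪ T = Set.univ ∧ Disjoint S T ∧ (G.induce S).IsTree ∧ (G.induce T).IsTree

/-!
Write `B i` for the set of big vertices of colour `i`, that is `bigVertices C i`.

**Extending forests.** Let `S` meet every face of the triangulation. If `G[S]` is disconnected, label
a component of it. The edges `tt'` outside `S` whose two faces have third corners with different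
labels form a nonempty graph, and as the label changes an even number of times along the link of a
vertex, no vertex has degree one in this graph; so it contains a cycle
(`MeetsFaces.preconnected`). Now let `S₀`, `T₀` be disjoint sets that span forests and both meet every
face, such that a vertex outside `S₀ ∪ T₀` has at most two neighbours in `S₀`. Enlarge `S₀` to a
maximal set `S` avoiding `T₀` that spans a forest. By maximality a vertex `t` outside `S ∪ T₀` has
both its neighbours in `S₀` in the same component of `G[S]`, so it is on no separating edge. Hence
the separating edges lie inside the forest `T₀`, so there are none and `G[S]` is a tree. Its
complement is then connected, since `G[S]` has no cycle of separating edges, and Euler's formula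
shows that the complement spans a tree, too: each face has exactly one side that does not run between
the two parts (`IsPlaneTriangulation.exists_isTreePartition`).

**Distributing the colours.** Take a colour `k` for which `G[B k ∪ B i]` and `G[B k ∪ B j]` are
acyclic, where `i` and `j` are the other two colours. The colours `i` and `j` go to different trees
and `B k` is split between them in some way. The link of a vertex is a cycle on which two colours
alternate; so a small vertex has degree two or four, and at most two neighbours of each colour. A
small vertex of colour `i` is therefore a leaf over the part of colour `k` in its tree, unless its
neighbours of colour `k` all belong to that part; in this case it is left undecided, as are the small
vertices of colour `k`. This meets the hypotheses of the extension result
(`IsPlaneTriangulation.exists_of_classes`). Three variants realise particular trees: a star at a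
vertex of colour `k` (`exists_star`), a vertex of colour `i` moved to the tree of colour `j`
(`exists_move`), and a small vertex that connects two components of the part of colour `k`
(`exists_connect`).

**Paths.** The theorem follows by cases on the colours in the path. In most cases one of the variants
works. The remaining case, a path `abc` to be separated into `ab` and `c` where `a`, `c` are small
vertices of colour `k` (`exists_separating_kik_of_small`), comes down to a configuration that would
be a subdivision of `K₃,₃` (`IsPlaneTriangulation.not_crossing`); it is excluded by the fact that a
triangle is, mod `2`, the boundary of a set of faces, again a consequence of Euler's formula.
-/

/-! ### Forests inside vertex sets -/

namespace SimpleGraph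

variable {V : Type*} {G : SimpleGraph V}

/-- The edges of `G` with both ends in `S`, as a graph on all of `V`; up to isolated vertices this
is `G.induce S`, but all sets `S` share one vertex type. -/
def inside (G : SimpleGraph V) (S : Set V) : SimpleGraph V where
  Adj u v := G.Adj u v ∧ u ∈ S ∧ v ∈ S
  symm := ⟨fun _ _ h => ⟨h.1.symm, h.2.2, h.2.1⟩⟩
  loopless := ⟨fun _ h => G.loopless.irrefl _ h.1⟩

theorem inside_adj {S : Set V} {u v : V} :
    (G.inside S).Adj u v ↔ G.Adj u v ∧ u ∈ S ∧ v ∈ S := Iff.rfl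

theorem inside_mono {S T : Set V} (h : S ⊆ T) : G.inside S ≤ G.inside T :=
  fun _ _ e => ⟨e.1, h e.2.1, h e.2.2⟩

theorem IsAcyclic.inside_anti {S T : Set V} (hT : (G.inside T).IsAcyclic) (h : S ⊆ T) :
    (G.inside S).IsAcyclic := hT.anti (inside_mono h)

theorem Reachable.mem_of_closed {H : SimpleGraph V} {D : Set V}
    (hD : ∀ x y, x ∈ D → H.Adj x y → y ∈ D) {u v : V} (h : H.Reachable u v) (hu : u ∈ D) :
    v ∈ D := by
  obtain ⟨p⟩ := h
  induction p with
  | nil => exact hu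
  | cons e _ ih => exact ih (hD _ _ hu e)

theorem Reachable.induce_of_inside {S : Set V} {u v : V} (h : (G.inside S).Reachable u v)
    (hu : u ∈ S) (hv : v ∈ S) : (G.induce S).Reachable ⟨u, hu⟩ ⟨v, hv⟩ := by
  have := h.mem_of_closed (D := {w | ∃ hw : w ∈ S, (G.induce S).Reachable ⟨u, hu⟩ ⟨w, hw⟩}) ?_
    ⟨hu, Reachable.refl _⟩
  · exact this.2
  · rintro x y ⟨hx, hr⟩ e
    exact ⟨e.2.2, hr.trans (Adj.reachable (by simpa using e.1))⟩

theorem Walk.map_inside {S : Set V} {u v : V} (p : (G.inside S).Walk u v) (hu : u ∈ S) :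
    ∀ w ∈ p.support, w ∈ S := by
  induction p with
  | nil => simpa using hu
  | cons e q ih =>
    intro w hw
    rcases List.mem_cons.1 (by simpa using hw) with rfl | h
    · exact hu
    · exact ih e.2.2 w h

theorem isAcyclic_inside_iff {S : Set V} :
    (G.inside S).IsAcyclic ↔ (G.induce S).IsAcyclic := by
  constructor
  · intro h
    exact h.comap (G' := G.inside S) (G := G.induce S) ⟨Subtype.val, fun {a b} e => ⟨e, a.2, b.2⟩⟩
      Subtype.val_injective
  · intro h
    rw [isAcyclic_iff_forall_adj_isBridge] at h ⊢
    rintro v w e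
    have hb := h (v := ⟨v, e.2.1⟩) (w := ⟨w, e.2.2⟩) e.1
    rw [isBridge_iff] at hb ⊢
    intro hr
    apply hb
    have := hr.mem_of_closed (D := {x | ∃ hx : x ∈ S,
      ((G.induce S).deleteEdges {s(⟨v, e.2.1⟩, ⟨w, e.2.2⟩)}).Reachable
        ⟨v, e.2.1⟩ ⟨x, hx⟩}) ?_ ⟨e.2.1, Reachable.refl _⟩
    · exact this.2
    · rintro x y ⟨hx, hr⟩ e'
      refine ⟨e'.1.2.2, hr.trans (Adj.reachable ?_)⟩
      have h1 := e'.1.1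
      have h2 := e'.2
      simp only [deleteEdges_adj, comap_adj, Function.Embedding.subtype_apply,
        Set.mem_singleton_iff] at h2 ⊢
      refine ⟨h1, fun h3 => h2 ?_⟩
      simpa [Sym2.eq_iff, e'.1.1.ne] using h3

/-- Adding a vertex to a forest gives a forest again, if no two neighbours of the new vertex lie in
the same component. -/
theorem IsAcyclic.inside_insert {S : Set V} {f : V} (hS : (G.inside S).IsAcyclic) (hf : f ∉ S)
    (h : ∀ u w, u ∈ S → w ∈ S → G.Adj f u → G.Adj f w → (G.inside S).Reachable u w → u = w) :
    (G.inside (insert f S)).IsAcyclic := by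
  have key : ∀ u, u ∈ S → G.Adj f u →
      ¬ ((G.inside (insert f S)).deleteEdges {s(u, f)}).Reachable u f := by
    intro u hu hfu hr
    have := hr.mem_of_closed (D := {x | x ∈ S ∧ (G.inside S).Reachable u x}) ?_
      ⟨hu, Reachable.refl _⟩
    · exact hf this.1
    · rintro x y ⟨hx, hrx⟩ e
      rw [deleteEdges_adj] at e
      obtain ⟨⟨e1, -, e2⟩, e3⟩ := e
      rcases e2 with rfl | hy
      · exact absurd (by rw [h u x hu hx hfu e1.symm hrx]; rfl) e3
      · exact ⟨hy, hrx.trans (Adj.reachable ⟨e1, hx, hy⟩)⟩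
  rw [isAcyclic_iff_forall_adj_isBridge] at hS ⊢
  intro x y e
  rw [isBridge_iff]
  obtain ⟨e1, ex, ey⟩ := e
  rcases ex with rfl | hx
  · rcases ey with rfl | hy
    · exact absurd e1 (G.loopless.irrefl _)
    · intro hr
      exact key y hy e1 (by rw [Sym2.eq_swap]; exact hr.symm)
  rcases ey with rfl | hy
  · exact key x hx e1.symm
  -- `D` collects what can be reached from `x` without the edge `xy`
  have hb := hS (v := x) (w := y) ⟨e1, hx, hy⟩
  rw [isBridge_iff] at hb
  intro hr
  set H' := (G.inside S).deleteEdges {s(x, y)} with hH'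
  have hle : H' ≤ G.inside S := deleteEdges_le _
  by_cases hu : ∃ u, u ∈ S ∧ G.Adj f u ∧ H'.Reachable x u
  · obtain ⟨u, huS, hfu, hxu⟩ := hu
    have := hr.mem_of_closed (D := {z | (z ∈ S ∧ H'.Reachable x z) ∨ z = f ∨
      (z ∈ S ∧ ¬ (G.inside S).Reachable x z)}) ?_ (Or.inl ⟨hx, Reachable.refl _⟩)
    · rcases this with h1 | h1 | h1
      · exact hb h1.2
      · exact hf (h1 ▸ hy)
      · exact h1.2 (Adj.reachable ⟨e1, hx, hy⟩)
    · intro w z hw e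
      rw [deleteEdges_adj] at e
      obtain ⟨⟨e1', ew, ez⟩, e3⟩ := e
      rcases ez with rfl | hz
      · exact Or.inr (Or.inl rfl)
      · rcases hw with h1 | h1 | h1
        · exact Or.inl ⟨hz, h1.2.trans (Adj.reachable ((deleteEdges_adj ..).2
            ⟨⟨e1', h1.1, hz⟩, e3⟩))⟩
        · subst h1
          by_cases hxz : (G.inside S).Reachable x z
          · have := h u z huS hz hfu e1' ((hxu.mono hle).symm.trans hxz)
            subst this
            exact Or.inl ⟨hz, hxu⟩
          · exact Or.inr (Or.inr ⟨hz, hxz⟩)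
        · refine Or.inr (Or.inr ⟨hz, fun h2 => h1.2 (h2.trans (Adj.reachable
            ⟨e1'.symm, hz, h1.1⟩))⟩)
  · have := hr.mem_of_closed (D := {z | z ∈ S ∧ H'.Reachable x z}) ?_ ⟨hx, Reachable.refl _⟩
    · exact hb this.2
    · rintro w z ⟨hw, hxw⟩ e
      rw [deleteEdges_adj] at e
      obtain ⟨⟨e1', -, ez⟩, e3⟩ := e
      rcases ez with rfl | hz
      · exact absurd ⟨w, hw, e1'.symm, hxw⟩ hu
      · exact ⟨hz, hxw.trans (Adj.reachable ((deleteEdges_adj ..).2 ⟨⟨e1', hw, hz⟩, e3⟩))⟩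

/-- Adding vertices with at most one neighbour in the new set keeps a forest a forest. -/
theorem IsAcyclic.inside_union_leaves [Finite V] {S : Set V} (hS : (G.inside S).IsAcyclic)
    (L : Set V) (h : ∀ l ∈ L, ∀ u w, u ∈ S ∪ L → w ∈ S ∪ L → G.Adj l u → G.Adj l w → u = w) :
    (G.inside (S ∪ L)).IsAcyclic := by
  induction L, L.toFinite using Set.Finite.induction_on with
  | empty => simpa using hS
  | @insert l L hl _ ih =>
    have hsub : S ∪ L ⊆ S ∪ insert l L := Set.union_subset_union_right _ (Set.subset_insert _ _)
    have ih' := ih (fun m hm u w hu hw => h m (Set.mem_insert_of_mem _ hm) u w (hsub hu) (hsub hw))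
    rw [Set.union_insert]
    by_cases hlS : l ∈ S ∪ L
    · rwa [Set.insert_eq_of_mem hlS]
    · exact ih'.inside_insert hlS fun u w hu hw h1 h2 _ =>
        h l (Set.mem_insert _ _) u w (hsub hu) (hsub hw) h1 h2

theorem isAcyclic_inside_of_independent {S : Set V} (h : ∀ u v, u ∈ S → v ∈ S → ¬ G.Adj u v) :
    (G.inside S).IsAcyclic := by
  have : G.inside S = ⊥ := by
    ext u v
    simp only [inside_adj, bot_adj, iff_false]
    exact fun e => h u v e.2.1 e.2.2 e.1
  rw [this]
  exact isAcyclic_bot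

/-- A forest has no nonempty set of edges that meets every vertex in no edge or in at least two
edges. -/
theorem IsAcyclic.not_exists_two_le_degree [Finite V] {S : Set V} (hS : (G.inside S).IsAcyclic)
    {Z : V → V → Prop} (hsymm : ∀ u v, Z u v → Z v u)
    (hZ : ∀ u v, Z u v → (G.inside S).Adj u v) (h2 : ∀ u v, Z u v → ∃ w, w ≠ v ∧ Z u w) (u v : V) :
    ¬ Z u v := by
  classical
  intro huv
  let H : SimpleGraph V :=
    { Adj := Z
      symm := ⟨fun a b => hsymm a b⟩
      loopless := ⟨fun a ha => (G.inside S).loopless.irrefl a (hZ a a ha)⟩ }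
  have hH : H.IsAcyclic := hS.anti (fun a b e => hZ a b e)
  have ht := hH.isTree_connectedComponent (H.connectedComponentMk u)
  have := Fintype.ofFinite V
  have : Nontrivial (H.connectedComponentMk u).supp := by
    refine ⟨⟨⟨u, rfl⟩, ⟨v, ?_⟩, ?_⟩⟩
    · exact ConnectedComponent.sound (Adj.reachable (G := H) (hsymm _ _ huv))
    · intro h
      exact (H.ne_of_adj huv) (congrArg Subtype.val h)
  obtain ⟨⟨x, hx⟩, hdeg⟩ := ht.exists_vert_degree_one_of_nontrivial
  rw [degree_eq_one_iff_existsUnique_adj] at hdeg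
  obtain ⟨⟨y, hy⟩, hxy, huniq⟩ := hdeg
  have hxy' : H.Adj x y := hxy
  obtain ⟨w, hw, hxw⟩ := h2 x y hxy'
  have hwmem : w ∈ (H.connectedComponentMk u).supp := by
    have hx' : H.connectedComponentMk x = H.connectedComponentMk u := hx
    change H.connectedComponentMk w = H.connectedComponentMk u
    rw [← hx']
    exact ConnectedComponent.sound (Adj.reachable (G := H) (hsymm _ _ hxw))
  have := huniq ⟨w, hwmem⟩ hxw
  exact hw (congrArg Subtype.val this)

/-- In a forest, two vertices of one component are separated by removing the first vertex after
`u` on the path from `u` to `v`. -/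
theorem IsAcyclic.exists_adj_not_reachable {S : Set V} (hS : (G.inside S).IsAcyclic) {u v : V}
    (huv : u ≠ v) (hr : (G.inside S).Reachable u v) :
    ∃ y, (G.inside S).Adj u y ∧ ¬ (G.inside (S \ {y})).Reachable u v := by
  classical
  obtain ⟨p⟩ := hr
  set q := p.toPath with hq
  obtain ⟨q, hqp⟩ := q
  cases q with
  | nil => exact absurd rfl huv
  | @cons _ y _ e q =>
    refine ⟨y, e, ?_⟩
    rintro ⟨r⟩
    have hle : G.inside (S \ {y}) ≤ G.inside S := inside_mono Set.sdiff_subset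
    have huS : u ∈ S \ {y} := ⟨e.2.1, fun h => (G.ne_of_adj e.1) h⟩
    set r' := r.toPath with hr'
    have h1 : ∀ w ∈ (r'.1.mapLe hle).support, w ∈ S \ {y} := by
      rw [Walk.support_mapLe_eq_support]
      exact Walk.map_inside _ huS
    have := (hS.subsingleton_path u v).elim ⟨_, hqp⟩ ⟨r'.1.mapLe hle, r'.2.mapLe hle⟩
    have h2 : y ∈ (r'.1.mapLe hle).support := by
      have h3 : Walk.cons e q = r'.1.mapLe hle := congrArg Subtype.val this
      rw [← h3]
      simp
    exact (h1 y h2).2 rfl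

theorem IsAcyclic.not_four_cycle {S : Set V} (hS : (G.inside S).IsAcyclic) {u w x y : V}
    (huw : u ≠ w) (hux : (G.inside S).Adj u x) (hxw : (G.inside S).Adj x w)
    (huy : (G.inside S).Adj u y) (hyw : (G.inside S).Adj y w) : x = y := by
  have := (hS.subsingleton_path u w).elim ⟨.cons hux (.cons hxw .nil), by
      simp [huw, hux.ne, hxw.ne]⟩ ⟨.cons huy (.cons hyw .nil), by simp [huw, huy.ne, hyw.ne]⟩
  have h := congrArg (fun p : (G.inside S).Path u w => p.1.support) this
  simpa using h

end SimpleGraph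

/-! ### Rotations, faces and separations -/

namespace RotationSystem

variable {V : Type*} {G : SimpleGraph V}

/-- `w` is the neighbour of `v` that follows the neighbour `u` in the rotation at `v`. In a
triangulation, `v`, `u`, `w` are then the corners of a face, see `Follows.rotate`. -/
def Follows (R : RotationSystem G) (v u w : V) : Prop :=
  ∃ h : G.Adj v u, (R.rot ⟨(v, u), h⟩).snd = w

variable {R : RotationSystem G}

theorem Follows.adj_left {v u w : V} (h : R.Follows v u w) : G.Adj v u := h.1

theorem Follows.adj_right {v u w : V} (h : R.Follows v u w) : G.Adj v w := by
  obtain ⟨h, rfl⟩ := h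
  have := (R.rot ⟨(v, u), h⟩).adj
  rwa [R.fst_rot] at this

theorem Follows.rot_eq {v u w : V} (h : R.Follows v u w) :
    R.rot ⟨(v, u), h.adj_left⟩ = ⟨(v, w), h.adj_right⟩ := by
  apply SimpleGraph.Dart.ext
  exact Prod.ext (R.fst_rot _) h.2

theorem follows_of_rot_eq {v u w : V} {h : G.Adj v u} {h' : G.Adj v w}
    (e : R.rot ⟨(v, u), h⟩ = ⟨(v, w), h'⟩) : R.Follows v u w :=
  ⟨h, by rw [e]⟩

theorem exists_follows {v u : V} (h : G.Adj v u) : ∃ w, R.Follows v u w := ⟨_, h, rfl⟩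

theorem Follows.right_unique {v u w w' : V} (h : R.Follows v u w) (h' : R.Follows v u w') :
    w = w' := by
  obtain ⟨_, rfl⟩ := h
  exact h'.2

theorem Follows.left_unique {v u u' w : V} (h : R.Follows v u w) (h' : R.Follows v u' w) :
    u = u' := by
  have := R.rot.injective (h.rot_eq.trans h'.rot_eq.symm)
  exact congrArg (fun d : G.Dart => d.snd) this

theorem facePerm_apply (d : G.Dart) : R.facePerm d = R.rot d.symm := rfl

theorem Follows.facePerm_eq {v u w : V} (h : R.Follows v u w) :
    R.facePerm ⟨(u, v), h.adj_left.symm⟩ = ⟨(v, w), h.adj_right⟩ := h.rot_eq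

/-- The corners of a triangular face may be permuted cyclically. -/
theorem Follows.rotate (hR : ∀ d : G.Dart, R.facePerm (R.facePerm (R.facePerm d)) = d) {v u w : V}
    (h : R.Follows v u w) : R.Follows u w v := by
  obtain ⟨z, hz⟩ := exists_follows (R := R) h.adj_right.symm
  have h1 := hR ⟨(u, v), h.adj_left.symm⟩
  rw [h.facePerm_eq, hz.facePerm_eq] at h1
  have h2 : z = u := by
    have := R.fst_rot (SimpleGraph.Dart.symm ⟨(w, z), hz.adj_right⟩)
    rw [← facePerm_apply, h1] at this
    exact this.symm
  subst h2
  exact follows_of_rot_eq h1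

theorem Follows.adj (hR : ∀ d : G.Dart, R.facePerm (R.facePerm (R.facePerm d)) = d) {v u w : V}
    (h : R.Follows v u w) : G.Adj u w := (h.rotate hR).adj_left

/-- A property of neighbours of `v` that is passed on along the rotation at `v` holds for all
neighbours once it holds for one. -/
theorem link_induction [Finite V] {v u₀ : V} {K : V → Prop} (h₀ : G.Adj v u₀) (hu₀ : K u₀)
    (hK : ∀ u w, R.Follows v u w → K u → K w) {u : V} (h : G.Adj v u) : K u := by
  classical
  have := Fintype.ofFinite V
  have hs := R.sameCycle_of_fst_eq ⟨(v, u₀), h₀⟩ ⟨(v, u), h⟩ rfl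
  obtain ⟨n, hn⟩ := hs.exists_nat_pow_eq
  have : ∀ n : ℕ, ((R.rot ^ n) ⟨(v, u₀), h₀⟩).fst = v ∧ K ((R.rot ^ n) ⟨(v, u₀), h₀⟩).snd := by
    intro n
    induction n with
    | zero => exact ⟨rfl, hu₀⟩
    | succ n ih =>
      rw [pow_succ', Equiv.Perm.mul_apply]
      set d := (R.rot ^ n) ⟨(v, u₀), h₀⟩
      have hd : G.Adj v d.snd := by rw [← ih.1]; exact d.adj
      have hd' : (⟨(v, d.snd), hd⟩ : G.Dart) = d :=
        SimpleGraph.Dart.ext _ _ (Prod.ext ih.1.symm rfl)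
      exact ⟨(R.fst_rot d).trans ih.1, hK d.snd _ ⟨hd, by rw [hd']⟩ ih.2⟩
  have h1 := (this n).2
  rw [hn] at h1
  exact h1

/-- Every face has a corner in `S`. -/
def MeetsFaces (R : RotationSystem G) (S : Set V) : Prop :=
  ∀ v u w, R.Follows v u w → v ∈ S ∨ u ∈ S ∨ w ∈ S

/-- The edge `tt'` avoids `S`, and the third corners of its two faces are told apart by `ℓ`. -/
def Separates (R : RotationSystem G) (S : Set V) (ℓ : V → Prop) (t t' : V) : Prop :=
  t ∉ S ∧ t' ∉ S ∧ ∃ p q, R.Follows t p t' ∧ R.Follows t t' q ∧ ¬ (ℓ p ↔ ℓ q)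

variable {S : Set V} {ℓ : V → Prop}

theorem Separates.symm (hR : ∀ d : G.Dart, R.facePerm (R.facePerm (R.facePerm d)) = d) {t t' : V}
    (h : R.Separates S ℓ t t') : R.Separates S ℓ t' t := by
  obtain ⟨h1, h2, p, q, hp, hq, hpq⟩ := h
  exact ⟨h2, h1, q, p, hq.rotate hR, (hp.rotate hR).rotate hR, fun e => hpq e.symm⟩

/-- Running once around a vertex, the label `ℓ` changes an even number of times; so a vertex on one
separating edge is on at least two of them. -/
theorem Separates.exists_ne [Finite V]
    (hR : ∀ d : G.Dart, R.facePerm (R.facePerm (R.facePerm d)) = d)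
    (hS : R.MeetsFaces S) (hℓ : ∀ u v, u ∈ S → v ∈ S → G.Adj u v → ℓ u → ℓ v) {t t' : V}
    (h : R.Separates S ℓ t t') : ∃ w, w ≠ t' ∧ R.Separates S ℓ t w := by
  obtain ⟨ht, ht', p, q, hp, hq, hpq⟩ := h
  by_contra hcon
  push Not at hcon
  have hmem : ∀ u w, u ∉ S → R.Follows t u w → w ∈ S := by
    intro u w hu hf
    rcases hS _ _ _ hf with h | h | h
    · exact absurd h ht
    · exact absurd h hu
    · exact h
  have hmem' : ∀ u w, w ∉ S → R.Follows t u w → u ∈ S := by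
    intro u w hu hf
    rcases hS _ _ _ hf with h | h | h
    · exact absurd h ht
    · exact h
    · exact absurd h hu
  have key : ∀ u, G.Adj t u → (u = t' ∨ (u ∈ S ∧ (ℓ u ↔ ℓ q)) ∨
      (u ∉ S ∧ ∀ w, R.Follows t u w → (ℓ w ↔ ℓ q))) := by
    intro u hu
    refine link_induction (R := R)
      (K := fun u => u = t' ∨ (u ∈ S ∧ (ℓ u ↔ ℓ q)) ∨
        (u ∉ S ∧ ∀ w, R.Follows t u w → (ℓ w ↔ ℓ q)))
      hq.adj_left (Or.inl rfl) ?_ hu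
    rintro u w hf (rfl | ⟨h1, h2⟩ | ⟨h1, h2⟩)
    · obtain rfl := hf.right_unique hq
      exact Or.inr (Or.inl ⟨hmem _ _ ht' hf, Iff.rfl⟩)
    · by_cases hw : w ∈ S
      · have hadj := hf.adj hR
        exact Or.inr (Or.inl ⟨hw, Iff.trans ⟨hℓ _ _ hw h1 hadj.symm, hℓ _ _ h1 hw hadj⟩ h2⟩)
      · by_cases hwt : w = t'
        · exact Or.inl hwt
        · refine Or.inr (Or.inr ⟨hw, fun z hz => ?_⟩)
          by_contra hne
          exact hcon w hwt ⟨ht, hw, u, z, hf, hz, fun e => hne (e.symm.trans h2)⟩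
    · exact Or.inr (Or.inl ⟨hmem _ _ h1 hf, h2 w hf⟩)
  have hpS := hmem' _ _ ht' hp
  rcases key p hp.adj_left with h | h | h
  · exact ht' (h ▸ hpS)
  · exact hpq h.2
  · exact h.1 hpS

/-- Without separating edges the label is constant. -/
theorem label_of_forall_not_separates [Finite V] (hG : G.Connected)
    (hR : ∀ d : G.Dart, R.facePerm (R.facePerm (R.facePerm d)) = d)
    (hS : R.MeetsFaces S) (hℓ : ∀ u v, u ∈ S → v ∈ S → G.Adj u v → ℓ u → ℓ v)
    (hZ : ∀ t t', ¬ R.Separates S ℓ t t') {u₀ : V} (hu₀ : u₀ ∈ S) (h₀ : ℓ u₀) {v : V}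
    (hv : v ∈ S) : ℓ v := by
  have link : ∀ t u w, t ∉ S → u ∈ S → ℓ u → G.Adj t u → w ∈ S → G.Adj t w → ℓ w := by
    intro t u w ht hu hlu htu hw htw
    have : (w ∈ S ∧ ℓ w) ∨ (w ∉ S ∧ ∀ z, R.Follows t w z → ℓ z) := by
      refine link_induction (R := R)
        (K := fun w => (w ∈ S ∧ ℓ w) ∨ (w ∉ S ∧ ∀ z, R.Follows t w z → ℓ z)) htu
        (Or.inl ⟨hu, hlu⟩) ?_ htw
      rintro x y hf (⟨h1, h2⟩ | ⟨h1, h2⟩)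
      · by_cases hy : y ∈ S
        · exact Or.inl ⟨hy, hℓ _ _ h1 hy (hf.adj hR) h2⟩
        · refine Or.inr ⟨hy, fun z hz => ?_⟩
          by_contra hne
          exact hZ t y ⟨ht, hy, x, z, hf, hz, fun e => hne (e.1 h2)⟩
      · refine Or.inl ⟨?_, h2 y hf⟩
        rcases hS _ _ _ hf with h | h | h
        · exact absurd h ht
        · exact absurd h h1
        · exact h
    rcases this with h | h
    · exact h.2
    · exact absurd hw h.1
  have hall : v ∈ {v | (v ∈ S ∧ ℓ v) ∨ (v ∉ S ∧ ∀ u, u ∈ S → G.Adj v u → ℓ u)} := by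
    refine (hG.preconnected u₀ v).mem_of_closed ?_ (Or.inl ⟨hu₀, h₀⟩)
    rintro x y (⟨hx, hlx⟩ | ⟨hx, hlx⟩) e
    · by_cases hy : y ∈ S
      · exact Or.inl ⟨hy, hℓ _ _ hx hy e hlx⟩
      · exact Or.inr ⟨hy, fun u hu hyu => link y x u hy hx hlx e.symm hu hyu⟩
    · by_cases hy : y ∈ S
      · exact Or.inl ⟨hy, hlx y hy e⟩
      · refine Or.inr ⟨hy, fun u hu hyu => ?_⟩
        obtain ⟨z, hz⟩ := exists_follows (R := R) e
        have hzS : z ∈ S := by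
          rcases hS _ _ _ hz with h | h | h
          · exact absurd h hx
          · exact absurd h hy
          · exact h
        exact link y z u hy hzS (hlx z hzS hz.adj_right) (hz.adj hR) hu hyu
  rcases hall with h | h
  · exact h.2
  · exact absurd hv h.1

/-- Let `S` meet every face, and let `T₀` span a forest and contain every edge that could separate
two components of `G.inside S`. Then `S` induces a connected graph. -/
theorem MeetsFaces.preconnected [Finite V] (hG : G.Connected)
    (hR : ∀ d : G.Dart, R.facePerm (R.facePerm (R.facePerm d)) = d)
    (hS : R.MeetsFaces S) {T₀ : Set V} (hT₀ : (G.inside T₀).IsAcyclic)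
    (hZ : ∀ u t t', R.Separates S (fun v => (G.inside S).Reachable u v) t t' → t ∈ T₀)
    {u v : V} (hu : u ∈ S) (hv : v ∈ S) : (G.inside S).Reachable u v := by
  have hℓ : ∀ x y, x ∈ S → y ∈ S → G.Adj x y → (G.inside S).Reachable u x →
      (G.inside S).Reachable u y :=
    fun x y hx hy e h => h.trans (SimpleGraph.Adj.reachable ⟨e, hx, hy⟩)
  refine label_of_forall_not_separates (ℓ := fun v => (G.inside S).Reachable u v) hG hR hS hℓ
    ?_ hu (SimpleGraph.Reachable.refl _) hv
  refine hT₀.not_exists_two_le_degree (fun _ _ h => h.symm hR) ?_ ?_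
  · rintro t t' h
    obtain ⟨_, _, p, _, hp, _⟩ := id h
    exact ⟨hp.adj_right, hZ _ _ _ h, hZ _ _ _ (h.symm hR)⟩
  · exact fun t t' h => h.exists_ne hR hS hℓ

end RotationSystem

/-! ### Euler's formula and tree partitions -/

namespace RotationSystem

variable {V : Type*} {G : SimpleGraph V} {R : RotationSystem G} {S : Set V}

theorem facePerm_fst (d : G.Dart) : (R.facePerm d).fst = d.snd := R.fst_rot _

theorem follows_of_dart (d : G.Dart) : R.Follows d.snd d.fst (R.facePerm d).snd := ⟨d.adj.symm, rfl⟩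

/-- In a triangulation, if each face meets `S` and its complement, then exactly one of the three
sides of a face joins two vertices of the same part. -/
theorem existsUnique_monochromatic (hS : R.MeetsFaces S) (hT : R.MeetsFaces Sᶜ)
    (hR : ∀ d : G.Dart, R.facePerm (R.facePerm (R.facePerm d)) = d) (d : G.Dart) :
    ((d.fst ∈ S ↔ d.snd ∈ S) ∧ ¬ ((R.facePerm d).fst ∈ S ↔ (R.facePerm d).snd ∈ S) ∧
      ¬ ((R.facePerm (R.facePerm d)).fst ∈ S ↔ (R.facePerm (R.facePerm d)).snd ∈ S)) ∨
    (¬ (d.fst ∈ S ↔ d.snd ∈ S) ∧ ((R.facePerm d).fst ∈ S ↔ (R.facePerm d).snd ∈ S) ∧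
      ¬ ((R.facePerm (R.facePerm d)).fst ∈ S ↔ (R.facePerm (R.facePerm d)).snd ∈ S)) ∨
    (¬ (d.fst ∈ S ↔ d.snd ∈ S) ∧ ¬ ((R.facePerm d).fst ∈ S ↔ (R.facePerm d).snd ∈ S) ∧
      ((R.facePerm (R.facePerm d)).fst ∈ S ↔ (R.facePerm (R.facePerm d)).snd ∈ S)) := by
  have h1 := facePerm_fst (R := R) d
  have h2 := facePerm_fst (R := R) (R.facePerm d)
  have h3 := facePerm_fst (R := R) (R.facePerm (R.facePerm d))
  rw [hR] at h3
  have h4 := hS _ _ _ (follows_of_dart (R := R) d)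
  have h5 := hT _ _ _ (follows_of_dart (R := R) d)
  simp only [Set.mem_compl_iff] at h5
  rw [h1, h2, ← h3]
  tauto

/-- Euler's formula for a plane triangulation, in the form: if each face meets both `S` and its
complement, then the two parts together span two edges less than `G` has vertices. -/
theorem IsPlaneTriangulation.card_edges_add_card_edges [Finite V] (hR : R.IsPlaneTriangulation)
    (hS : R.MeetsFaces S) (hT : R.MeetsFaces Sᶜ) :
    Nat.card (G.induce S).edgeSet + Nat.card (G.induce Sᶜ).edgeSet + 2 = Nat.card V := by
  classical
  have := Fintype.ofFinite V
  obtain ⟨⟨_, heuler⟩, htri⟩ := hR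
  have hex := existsUnique_monochromatic hS hT htri
  set M : G.Dart → Prop := fun d => (d.fst ∈ S ↔ d.snd ∈ S) with hM
  -- each face has exactly one monochromatic side
  have hface : Nat.card {d // M d} = Nat.card R.Face := by
    refine Nat.card_eq_of_bijective
      (fun d : {d // M d} => (Quotient.mk (Equiv.Perm.SameCycle.setoid R.facePerm) d.1 : R.Face))
      ⟨?_, ?_⟩
    · rintro ⟨d, hd⟩ ⟨e, he⟩ h
      have hs : R.facePerm.SameCycle d e := Quotient.exact h
      obtain ⟨n, hn⟩ := hs.exists_nat_pow_eq
      have h3 : ∀ n, (R.facePerm ^ n) d = d ∨ (R.facePerm ^ n) d = R.facePerm d ∨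
          (R.facePerm ^ n) d = R.facePerm (R.facePerm d) := by
        intro n
        induction n with
        | zero => exact Or.inl rfl
        | succ n ih =>
          rw [pow_succ', Equiv.Perm.mul_apply]
          rcases ih with h | h | h <;> rw [h]
          · exact Or.inr (Or.inl rfl)
          · exact Or.inr (Or.inr rfl)
          · exact Or.inl (htri d)
      have := hex d
      rcases h3 n with h | h | h <;> rw [hn] at h <;> subst h <;>
        simp only [hM] at hd he <;> first | rfl | tauto
    · intro f
      induction f using Quotient.inductionOn with
      | h d =>
        rcases hex d with h | h | h
        · exact ⟨⟨d, h.1⟩, rfl⟩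
        · exact ⟨⟨R.facePerm d, h.2.1⟩, Quotient.sound (⟨-1, by simp⟩)⟩
        · refine ⟨⟨R.facePerm (R.facePerm d), h.2.2⟩, Quotient.sound ⟨1, ?_⟩⟩
          rw [zpow_one]
          exact htri d
  have hdart : Fintype.card G.Dart = 3 * Fintype.card {d // M d} := by
    obtain ⟨f, hf⟩ : ∃ f : G.Dart → ℕ, ∀ d, f d = if M d then 1 else 0 := ⟨_, fun _ => rfl⟩
    have h1 : ∀ σ : Equiv.Perm G.Dart, ∑ d, f (σ d) = Fintype.card {d // M d} := by
      intro σ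
      rw [Equiv.sum_comp σ f, Finset.sum_congr rfl (fun d _ => hf d), Finset.sum_boole,
        Nat.cast_id, Fintype.card_subtype]
    have h2 : ∀ d : G.Dart, 1 = f d + f (R.facePerm d) + f (R.facePerm (R.facePerm d)) := by
      intro d
      rw [hf, hf, hf]
      rcases hex d with ⟨a, b, c⟩ | ⟨a, b, c⟩ | ⟨a, b, c⟩ <;>
        simp only [hM, a, b, c, if_true, if_false]
    have h3 := Finset.sum_congr (rfl : (Finset.univ : Finset G.Dart) = _) (fun d _ => h2 d)
    rw [Finset.sum_add_distrib, Finset.sum_add_distrib] at h3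
    have e1 : ∑ d, f d = _ := h1 1
    have e2 := h1 R.facePerm
    have e3 : ∑ d, f (R.facePerm (R.facePerm d)) = _ := h1 (R.facePerm * R.facePerm)
    rw [e1, e2, e3] at h3
    simp only [Finset.sum_const, Finset.card_univ, smul_eq_mul, mul_one] at h3
    omega
  have hmono : Fintype.card {d // M d} =
      Fintype.card (G.induce S).Dart + Fintype.card (G.induce Sᶜ).Dart := by
    rw [← Fintype.card_sum]
    symm
    refine Fintype.card_of_bijective (f := Sum.elim
      (fun d => ⟨⟨(d.fst.1, d.snd.1), d.adj⟩, iff_of_true d.fst.2 d.snd.2⟩)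
      (fun d => ⟨⟨(d.fst.1, d.snd.1), d.adj⟩, iff_of_false d.fst.2 d.snd.2⟩)) ⟨?_, ?_⟩
    · rintro (d | d) (e | e) h <;>
        simp only [Sum.elim_inl, Sum.elim_inr, Subtype.mk.injEq, SimpleGraph.Dart.ext_iff,
          Prod.ext_iff] at h
      · exact congrArg _ (SimpleGraph.Dart.ext _ _ (Prod.ext (Subtype.ext h.1) (Subtype.ext h.2)))
      · exact absurd d.fst.2 (by rw [h.1]; exact e.fst.2)
      · exact absurd e.fst.2 (by rw [← h.1]; exact d.fst.2)
      · exact congrArg _ (SimpleGraph.Dart.ext _ _ (Prod.ext (Subtype.ext h.1) (Subtype.ext h.2)))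
    · rintro ⟨d, hd⟩
      by_cases h : d.fst ∈ S
      · exact ⟨Sum.inl ⟨(⟨d.fst, h⟩, ⟨d.snd, hd.1 h⟩), d.adj⟩, rfl⟩
      · exact ⟨Sum.inr ⟨(⟨d.fst, h⟩, ⟨d.snd, fun h' => h (hd.2 h')⟩), d.adj⟩, rfl⟩
  have e1 := G.dart_card_eq_twice_card_edges
  have e2 := (G.induce S).dart_card_eq_twice_card_edges
  have e3 := (G.induce Sᶜ).dart_card_eq_twice_card_edges
  have c1 : Nat.card G.edgeSet = G.edgeFinset.card := by
    rw [Nat.card_eq_fintype_card, SimpleGraph.edgeFinset_card]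
  have c2 : Nat.card (G.induce S).edgeSet = (G.induce S).edgeFinset.card := by
    rw [Nat.card_eq_fintype_card, SimpleGraph.edgeFinset_card]
  have c3 : Nat.card (G.induce Sᶜ).edgeSet = (G.induce Sᶜ).edgeFinset.card := by
    rw [Nat.card_eq_fintype_card, SimpleGraph.edgeFinset_card]
  rw [Nat.card_eq_fintype_card (α := {d // M d})] at hface
  omega

/-- Disjoint induced forests `S₀` and `T₀` that both meet every face extend to a partition into two
induced trees, if every vertex outside them has at most two neighbours in `S₀`. The tree containing
`S₀` is a maximal forest avoiding `T₀`: if it were disconnected, the separating edges would form a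
nonempty even subgraph of the forest `T₀`. -/
theorem IsPlaneTriangulation.exists_isTreePartition [Finite V] (hR : R.IsPlaneTriangulation)
    {S₀ T₀ : Set V} (hd : Disjoint S₀ T₀) (hS₀ : (G.inside S₀).IsAcyclic)
    (hT₀ : (G.inside T₀).IsAcyclic) (hS : R.MeetsFaces S₀) (hT : R.MeetsFaces T₀)
    (hF : ∀ f, f ∉ S₀ → f ∉ T₀ → ∃ s s', ∀ x ∈ S₀, G.Adj f x → x = s ∨ x = s') :
    ∃ S, S₀ ⊆ S ∧ Disjoint S T₀ ∧ IsTreePartition G S Sᶜ := by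
  classical
  obtain ⟨⟨hG, heuler⟩, htri⟩ := id hR
  obtain ⟨S, hS₁, hmax⟩ := Set.Finite.exists_le_maximal
    (Set.toFinite {S : Set V | S₀ ⊆ S ∧ Disjoint S T₀ ∧ (G.inside S).IsAcyclic})
    (a := S₀) ⟨subset_rfl, hd, hS₀⟩
  obtain ⟨⟨hsub, hdis, hac⟩, hmax⟩ := hmax
  have hSf : R.MeetsFaces S := fun v u w h => (hS v u w h).imp (@hsub _) (Or.imp (@hsub _) (@hsub _))
  have hTf : R.MeetsFaces Sᶜ := by
    have : T₀ ⊆ Sᶜ := fun x hx hxS => Set.disjoint_left.1 hdis hxS hx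
    exact fun v u w h => (hT v u w h).imp (@this _) (Or.imp (@this _) (@this _))
  have hconn : ∀ u ∈ S, ∀ v ∈ S, (G.inside S).Reachable u v := by
    intro u hu v hv
    refine hSf.preconnected hG htri hT₀ ?_ hu hv
    rintro u t t' ⟨ht, ht', p, q, hp, hq, hpq⟩
    by_contra htT
    have hpS : p ∈ S := by
      rcases hSf _ _ _ hp with h | h | h
      · exact absurd h ht
      · exact h
      · exact absurd h ht'
    have hqS : q ∈ S := by
      rcases hSf _ _ _ hq with h | h | h
      · exact absurd h ht
      · exact absurd h ht'
      · exact h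
    -- neighbours of `t` in `S` lie in `S₀`
    have hnb : ∀ x ∈ S, G.Adj t x → x ∈ S₀ := by
      intro x hx htx
      by_contra hxS
      have hxT : x ∉ T₀ := fun h => Set.disjoint_left.1 hdis hx h
      obtain ⟨y, hy⟩ := exists_follows (R := R) htx
      have h1 : y ∈ S₀ := by
        rcases hS _ _ _ hy with h | h | h
        · exact absurd (hsub h) ht
        · exact absurd h hxS
        · exact h
      have h2 : y ∈ T₀ := by
        rcases hT _ _ _ hy with h | h | h
        · exact absurd h htT
        · exact absurd h hxT
        · exact h
      exact Set.disjoint_left.1 hd h1 h2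
    have hnac : ¬ (G.inside (insert t S)).IsAcyclic := by
      intro h
      have := hmax (y := insert t S) ⟨hsub.trans (Set.subset_insert _ _), ?_, h⟩
        (Set.subset_insert _ _)
      · exact ht (this (Set.mem_insert _ _))
      · rw [Set.disjoint_insert_left]
        exact ⟨htT, hdis⟩
    obtain ⟨x, y, hx, hy, htx, hty, hxy, hne⟩ : ∃ x y, x ∈ S ∧ y ∈ S ∧ G.Adj t x ∧ G.Adj t y ∧
        (G.inside S).Reachable x y ∧ x ≠ y := by
      by_contra hcon
      push Not at hcon
      exact hnac (hac.inside_insert ht hcon)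
    obtain ⟨s, s', hss⟩ := hF t (fun h => ht (hsub h)) htT
    have hreach : ∀ z ∈ S, G.Adj t z → (G.inside S).Reachable x z := by
      intro z hz htz
      have h1 := hss x (hnb x hx htx) htx
      have h2 := hss y (hnb y hy hty) hty
      have h3 := hss z (hnb z hz htz) htz
      have : z = x ∨ z = y := by
        rcases h1 with rfl | rfl <;> rcases h2 with rfl | rfl <;> tauto
      rcases this with rfl | rfl
      · exact SimpleGraph.Reachable.refl _
      · exact hxy
    have e1 := hreach p hpS hp.adj_left
    have e2 := hreach q hqS hq.adj_right
    exact hpq ⟨fun h => h.trans (e1.symm.trans e2), fun h => h.trans (e2.symm.trans e1)⟩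
  have hconnT : ∀ u ∈ Sᶜ, ∀ v ∈ Sᶜ, (G.inside Sᶜ).Reachable u v := by
    intro u hu v hv
    refine hTf.preconnected hG htri hac ?_ hu hv
    rintro u t t' ⟨ht, -⟩
    exact not_not.1 ht
  -- a graph without faces would contradict Euler's formula, so both parts are nonempty
  have hdart : Nonempty G.Dart := by
    by_contra hne
    rw [not_nonempty_iff] at hne
    have h1 : Nat.card R.Face = 0 := by
      have : IsEmpty R.Face := ⟨fun f => Quotient.inductionOn f (fun d => hne.elim d)⟩
      exact Nat.card_of_isEmpty
    have h2 := hG.card_vert_le_card_edgeSet_add_one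
    omega
  obtain ⟨d⟩ := hdart
  have hSne : S.Nonempty := by
    rcases hSf _ _ _ (follows_of_dart (R := R) d) with h | h | h <;> exact ⟨_, h⟩
  have hTne : Sᶜ.Nonempty := by
    rcases hTf _ _ _ (follows_of_dart (R := R) d) with h | h | h <;> exact ⟨_, h⟩
  have hcS : (G.induce S).Connected := by
    have := hSne.to_subtype
    exact ⟨fun u v => (hconn u u.2 v v.2).induce_of_inside u.2 v.2⟩
  have hcT : (G.induce Sᶜ).Connected := by
    have := hTne.to_subtype
    exact ⟨fun u v => (hconnT u u.2 v v.2).induce_of_inside u.2 v.2⟩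
  have htS : (G.induce S).IsTree := ⟨hcS, SimpleGraph.isAcyclic_inside_iff.1 hac⟩
  refine ⟨S, hsub, hdis, Set.union_compl_self S, disjoint_compl_right, htS, ?_⟩
  have h1 := (SimpleGraph.isTree_iff_connected_and_card.1 htS).2
  have h2 := hR.card_edges_add_card_edges hSf hTf
  refine SimpleGraph.isTree_iff_connected_and_card.2 ⟨hcT, ?_⟩
  have h3 : Nat.card S + Nat.card (Sᶜ : Set V) = Nat.card V := by
    have := Set.ncard_add_ncard_compl S
    rwa [← Nat.card_coe_set_eq, ← Nat.card_coe_set_eq] at this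
  omega

end RotationSystem

/-! ### Links of vertices of degree four -/

namespace RotationSystem

variable {V : Type*} {G : SimpleGraph V} {R : RotationSystem G}

theorem fin_three_eq {a b c : Fin 3} (hab : a ≠ b) (hac : a ≠ c) (hbc : b ≠ c) (x : Fin 3) :
    x = a ∨ x = b ∨ x = c := by
  revert a b c x; decide

theorem fin_three_third {a b x y : Fin 3} (hab : a ≠ b) (hxa : x ≠ a) (hxb : x ≠ b) (hya : y ≠ a)
    (hyb : y ≠ b) : x = y := by
  revert a b x y; decide

/-- The neighbours of `v`, in the order of the rotation, are `b`, `x`, `b'`, `y`. -/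
structure IsLink (R : RotationSystem G) (v b x b' y : V) : Prop where
  follows₁ : R.Follows v b x
  follows₂ : R.Follows v x b'
  follows₃ : R.Follows v b' y
  follows₄ : R.Follows v y b

namespace IsLink

variable {v b x b' y : V}

theorem rotate (h : R.IsLink v b x b' y) : R.IsLink v x b' y b :=
  ⟨h.follows₂, h.follows₃, h.follows₄, h.follows₁⟩

theorem eq_or [Finite V] (h : R.IsLink v b x b' y) {w : V} (hw : G.Adj v w) :
    w = b ∨ w = x ∨ w = b' ∨ w = y := by
  refine link_induction (R := R) (K := fun w => w = b ∨ w = x ∨ w = b' ∨ w = y)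
    h.follows₁.adj_left (Or.inl rfl) ?_ hw
  rintro u z hf (rfl | rfl | rfl | rfl)
  · exact Or.inr (Or.inl (hf.right_unique h.follows₁))
  · exact Or.inr (Or.inr (Or.inl (hf.right_unique h.follows₂)))
  · exact Or.inr (Or.inr (Or.inr (hf.right_unique h.follows₃)))
  · exact Or.inl (hf.right_unique h.follows₄)

end IsLink

theorem Follows.color_ne (hR : ∀ d : G.Dart, R.facePerm (R.facePerm (R.facePerm d)) = d)
    (C : G.Coloring (Fin 3)) {v u w : V} (h : R.Follows v u w) :
    C v ≠ C u ∧ C v ≠ C w ∧ C u ≠ C w :=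
  ⟨C.valid h.adj_left, C.valid h.adj_right, C.valid (h.adj hR)⟩

theorem Follows.color_eq (hR : ∀ d : G.Dart, R.facePerm (R.facePerm (R.facePerm d)) = d)
    (C : G.Coloring (Fin 3)) {v u w z : V} (h : R.Follows v u w) (h' : R.Follows v w z) :
    C z = C u := by
  have h1 := h.color_ne hR C
  have h2 := h'.color_ne hR C
  exact fin_three_third h1.2.1 h2.2.1.symm h2.2.2.symm h1.1.symm h1.2.2

/-- In a triangulation with a proper `3`-colouring the colours along a link alternate. So a vertex
of degree less than `6` has a link of length dividing `4`. -/
theorem exists_isLink [Fintype V] [DecidableRel G.Adj]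
    (hR : ∀ d : G.Dart, R.facePerm (R.facePerm (R.facePerm d)) = d) (C : G.Coloring (Fin 3))
    {v b : V} (hv : G.degree v < 6) (hb : G.Adj v b) : ∃ x b' y, R.IsLink v b x b' y := by
  classical
  obtain ⟨u1, h1⟩ := exists_follows (R := R) hb
  obtain ⟨u2, h2⟩ := exists_follows (R := R) h1.adj_right
  obtain ⟨u3, h3⟩ := exists_follows (R := R) h2.adj_right
  obtain ⟨u4, h4⟩ := exists_follows (R := R) h3.adj_right
  obtain ⟨u5, h5⟩ := exists_follows (R := R) h4.adj_right
  by_cases h40 : u4 = b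
  · exact ⟨u1, u2, u3, h1, h2, h3, h40 ▸ h4⟩
  exfalso
  have h20 : u2 ≠ b := by
    rintro rfl
    have e1 := h3.right_unique h1
    subst e1
    exact h40 (h4.right_unique h2)
  have h31 : u3 ≠ u1 := fun e => h20 (by subst e; exact h3.left_unique h1)
  have h42 : u4 ≠ u2 := fun e => h31 (by subst e; exact h4.left_unique h2)
  have h53 : u5 ≠ u3 := fun e => h42 (by subst e; exact h5.left_unique h3)
  have h51 : u5 ≠ u1 := fun e => h40 (by subst e; exact h5.left_unique h1)
  have c2 := h1.color_eq hR C h2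
  have c3 := h2.color_eq hR C h3
  have c4 := h3.color_eq hR C h4
  have c5 := h4.color_eq hR C h5
  have c01 := (h1.color_ne hR C).2.2
  have ne : ∀ {p q : V}, C p = C b → C q = C u1 → p ≠ q := by
    rintro p q hp hq rfl
    exact c01 (hp.symm.trans hq)
  have hc5 : C u5 = C u1 := c5.trans c3
  have hc4 : C u4 = C b := c4.trans c2
  have hsub : ({b, u1, u2, u3, u4, u5} : Finset V) ⊆ G.neighborFinset v := by
    intro z hz
    rw [SimpleGraph.mem_neighborFinset]
    simp only [Finset.mem_insert, Finset.mem_singleton] at hz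
    rcases hz with rfl | rfl | rfl | rfl | rfl | rfl
    exacts [hb, h1.adj_right, h2.adj_right, h3.adj_right, h4.adj_right, h5.adj_right]
  have hcard := Finset.card_le_card hsub
  rw [SimpleGraph.card_neighborFinset_eq_degree] at hcard
  have : ({b, u1, u2, u3, u4, u5} : Finset V).card = 6 := by
    rw [Finset.card_insert_of_notMem, Finset.card_insert_of_notMem, Finset.card_insert_of_notMem,
      Finset.card_insert_of_notMem, Finset.card_insert_of_notMem, Finset.card_singleton]
    all_goals simp only [Finset.mem_insert, Finset.mem_singleton, not_or]
    · exact (ne hc4 hc5)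
    · exact ⟨(ne hc4 c3).symm, h53.symm⟩
    · exact ⟨ne c2 c3, h42.symm, ne c2 hc5⟩
    · exact ⟨(ne c2 rfl).symm, h31.symm, (ne hc4 rfl).symm, h51.symm⟩
    · exact ⟨ne rfl rfl, h20.symm, ne rfl c3, Ne.symm h40, ne rfl hc5⟩
  omega

/-- A vertex of degree less than `6` has at most two neighbours of each colour. -/
theorem exists_forall_adj_color [Fintype V] [DecidableRel G.Adj]
    (hR : ∀ d : G.Dart, R.facePerm (R.facePerm (R.facePerm d)) = d) (C : G.Coloring (Fin 3))
    {v : V} (hv : G.degree v < 6) (c : Fin 3) :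
    ∃ s s', ∀ x, G.Adj v x → C x = c → x = s ∨ x = s' := by
  by_cases h : ∃ b, G.Adj v b ∧ C b = c
  · obtain ⟨b, hb, rfl⟩ := h
    obtain ⟨x, b', y, hl⟩ := exists_isLink hR C hv hb
    refine ⟨b, b', fun w hw hc => ?_⟩
    have h1 := (hl.follows₁.color_ne hR C).2.2
    have h2 := hl.follows₂.color_eq hR C hl.follows₃
    rcases hl.eq_or hw with rfl | rfl | rfl | rfl
    · exact Or.inl rfl
    · exact absurd hc.symm h1
    · exact Or.inr rfl
    · exact absurd (hc.symm.trans h2) h1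
  · exact ⟨v, v, fun x hx hc => absurd ⟨x, hx, hc⟩ h⟩

/-- No vertex has degree two. -/
def NoDegreeTwo (R : RotationSystem G) : Prop := ∀ v b x, R.Follows v b x → ¬ R.Follows v x b

/-- The only plane triangulation with a vertex of degree two is the triangle. -/
theorem Follows.eq_or_of_follows [Finite V] (hG : G.Connected)
    (hR : ∀ d : G.Dart, R.facePerm (R.facePerm (R.facePerm d)) = d) {v b x : V}
    (h : R.Follows v b x) (h' : R.Follows v x b) (w : V) : w = v ∨ w = b ∨ w = x := by
  have link : ∀ {p q r : V}, R.Follows p q r → R.Follows p r q → ∀ {w}, G.Adj p w →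
      w = q ∨ w = r := by
    intro p q r h1 h2 w hw
    refine link_induction (R := R) (K := fun w => w = q ∨ w = r) h1.adj_left (Or.inl rfl) ?_ hw
    rintro u z hf (rfl | rfl)
    · exact Or.inr (hf.right_unique h1)
    · exact Or.inl (hf.right_unique h2)
  have : w ∈ {w | w = v ∨ w = b ∨ w = x} := by
    refine (hG.preconnected v w).mem_of_closed ?_ (Or.inl rfl)
    rintro p q (rfl | rfl | rfl) e
    · rcases link h h' e with rfl | rfl <;> simp
    · rcases link (h.rotate hR) ((h'.rotate hR).rotate hR) e with rfl | rfl <;> simp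
    · rcases link ((h.rotate hR).rotate hR) (h'.rotate hR) e with rfl | rfl <;> simp
  exact this

theorem IsLink.ne [Finite V] {v b x b' y : V} (h2 : R.NoDegreeTwo) (h : R.IsLink v b x b' y) :
    b ≠ b' := by
  rintro rfl
  exact h2 _ _ _ h.follows₁ h.follows₂

/-- What the proof uses about the link of a vertex `v` of degree four: its neighbours are `b`, `b'`
of one colour and `x`, `y` of the other one, and each of `b`, `b'` is adjacent to both `x`, `y`. -/
structure IsColoredLink (C : G.Coloring (Fin 3)) (v b b' x y : V) : Prop where
  ne : b ≠ b'
  ne' : x ≠ y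
  color_b' : C b' = C b
  color_y : C y = C x
  color_ne : C b ≠ C x
  color_ne_b : C v ≠ C b
  color_ne_x : C v ≠ C x
  adj_b : G.Adj v b
  adj_b' : G.Adj v b'
  adj_x : G.Adj v x
  adj_y : G.Adj v y
  adj_bx : G.Adj b x
  adj_by : G.Adj b y
  adj_b'x : G.Adj b' x
  adj_b'y : G.Adj b' y
  eq_of_adj : ∀ w, G.Adj v w → C w = C b → w = b ∨ w = b'
  eq_of_adj' : ∀ w, G.Adj v w → C w = C x → w = x ∨ w = y

theorem IsLink.isColoredLink [Finite V]
    (hR : ∀ d : G.Dart, R.facePerm (R.facePerm (R.facePerm d)) = d) (h2 : R.NoDegreeTwo)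
    (C : G.Coloring (Fin 3)) {v b x b' y : V} (h : R.IsLink v b x b' y) :
    IsColoredLink C v b b' x y := by
  have h1 := h.follows₁.color_ne hR C
  have e1 := h.follows₁.color_eq hR C h.follows₂
  have e2 := h.follows₂.color_eq hR C h.follows₃
  refine ⟨h.ne h2, h.rotate.ne h2, e1, e2, h1.2.2, h1.1, h1.2.1, h.follows₁.adj_left,
    h.follows₂.adj_right, h.follows₁.adj_right, h.follows₃.adj_right, h.follows₁.adj hR,
    (h.follows₄.adj hR).symm, (h.follows₂.adj hR).symm, h.follows₃.adj hR, ?_, ?_⟩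
  · intro w hw hc
    rcases h.eq_or hw with rfl | rfl | rfl | rfl
    · exact Or.inl rfl
    · exact absurd hc.symm h1.2.2
    · exact Or.inr rfl
    · exact absurd (hc.symm.trans e2) h1.2.2
  · intro w hw hc
    rcases h.eq_or hw with rfl | rfl | rfl | rfl
    · exact absurd hc h1.2.2
    · exact Or.inl rfl
    · exact absurd (e1.symm.trans hc) h1.2.2
    · exact Or.inr rfl

theorem exists_isColoredLink [Fintype V] [DecidableRel G.Adj]
    (hR : ∀ d : G.Dart, R.facePerm (R.facePerm (R.facePerm d)) = d) (h2 : R.NoDegreeTwo)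
    (C : G.Coloring (Fin 3)) {v b : V} (hv : G.degree v < 6) (hb : G.Adj v b) :
    ∃ b' x y, IsColoredLink C v b b' x y ∧ R.IsLink v b x b' y := by
  obtain ⟨x, b', y, hl⟩ := exists_isLink hR C hv hb
  exact ⟨b', x, y, hl.isColoredLink hR h2 C, hl⟩

end RotationSystem

/-! ### Partitions built from the colour classes -/

theorem IsTreePartition.symm {V : Type*} {G : SimpleGraph V} {S T : Set V}
    (h : IsTreePartition G S T) : IsTreePartition G T S :=
  ⟨by rw [Set.union_comm]; exact h.1, h.2.1.symm, h.2.2.2, h.2.2.1⟩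

theorem IsTreePartition.notMem {V : Type*} {G : SimpleGraph V} {S T : Set V}
    (h : IsTreePartition G S T) {v : V} (hv : v ∈ T) : v ∉ S :=
  fun h' => Set.disjoint_left.1 h.2.1 h' hv

namespace RotationSystem

variable {V : Type*} {G : SimpleGraph V} {R : RotationSystem G}

section Forests

variable (C : G.Coloring (Fin 3))

theorem isAcyclic_inside_class (i : Fin 3) : (G.inside {v | C v = i}).IsAcyclic :=
  SimpleGraph.isAcyclic_inside_of_independent fun _ _ hu hv e => C.valid e (hu.trans hv.symm)

/-- One vertex together with a colour class spans a star and isolated vertices. -/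
theorem isAcyclic_inside_star (i : Fin 3) (x : V) :
    (G.inside (insert x {v | C v = i})).IsAcyclic := by
  by_cases hx : x ∈ {v | C v = i}
  · rw [Set.insert_eq_of_mem hx]
    exact isAcyclic_inside_class C i
  · refine (isAcyclic_inside_class C i).inside_insert hx fun u w hu _ _ _ h => ?_
    have := h.mem_of_closed (D := {u}) ?_ rfl
    · exact (Set.mem_singleton_iff.1 this).symm
    · rintro p q - e
      exact absurd (e.2.1.trans e.2.2.symm) (C.valid e.1)

/-- Two nonadjacent vertices with at most one common neighbour of colour `i` span a forest with the
colour class `i`. -/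
theorem isAcyclic_inside_two (i : Fin 3) {x y : V} (hxy : ¬ G.Adj x y) (hx : C x ≠ i)
    (h : ∀ u w, C u = i → C w = i → G.Adj x u → G.Adj x w → G.Adj y u → G.Adj y w → u = w) :
    (G.inside (insert y (insert x {v | C v = i}))).IsAcyclic := by
  by_cases hy : y ∈ insert x {v | C v = i}
  · rw [Set.insert_eq_of_mem hy]
    exact isAcyclic_inside_star C i x
  refine (isAcyclic_inside_star C i x).inside_insert hy fun u w hu hw hyu hyw hr => ?_
  have hcol : ∀ u, u ∈ insert x {v | C v = i} → G.Adj y u → C u = i := by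
    rintro u (rfl | hu) e
    · exact absurd e.symm hxy
    · exact hu
  -- a vertex of colour `i` that is not adjacent to `x` is isolated
  have iso : ∀ u w, C u = i → ¬ G.Adj x u → (G.inside (insert x {v | C v = i})).Reachable u w →
      w = u := by
    intro u w hu hxu hr
    refine hr.mem_of_closed (D := {u}) ?_ rfl
    rintro p q rfl ⟨e, -, rfl | hq⟩
    · exact absurd e.symm hxu
    · exact absurd (hu.trans hq.symm) (C.valid e)
  by_contra hne
  refine hne (h u w (hcol u hu hyu) (hcol w hw hyw) ?_ ?_ hyu hyw)
  · by_contra hxu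
    exact hne (iso u w (hcol u hu hyu) hxu hr).symm
  · by_contra hxw
    exact hne (iso w u (hcol w hw hyw) hxw hr.symm)

theorem isAcyclic_inside_singleton_union (i : Fin 3) (x : V) :
    (G.inside ({x} ∪ {v | C v = i})).IsAcyclic := by
  rw [← Set.insert_eq]
  exact isAcyclic_inside_star C i x

end Forests

theorem eq_of_mem_pair {s s' u w c : V} (hu : u = s ∨ u = s') (hw : w = s ∨ w = s')
    (hc : c = s ∨ c = s') (huc : u ≠ c) (hwc : w ≠ c) : u = w := by
  grind

variable [Fintype V] [DecidableRel G.Adj]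

/-- The small vertices of colour `i` all of whose neighbours of colour `k` lie in `P`. -/
def enclosed (C : G.Coloring (Fin 3)) (k i : Fin 3) (P : Set V) : Set V :=
  {w | C w = i ∧ G.degree w < 6 ∧ ∀ x, G.Adj w x → C x = k → x ∈ P}

variable {C : G.Coloring (Fin 3)} {k i j : Fin 3}

theorem enclosed_mono {P Q : Set V} (h : P ⊆ Q) : enclosed C k i P ⊆ enclosed C k i Q :=
  fun _ hw => ⟨hw.1, hw.2.1, fun x e hx => h (hw.2.2 x e hx)⟩

/-- A small vertex of colour `i` that is not enclosed by `P` has at most one neighbour in `P`. -/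
theorem subsingleton_adj_of_notMem_enclosed
    (hR : ∀ d : G.Dart, R.facePerm (R.facePerm (R.facePerm d)) = d) {P : Set V}
    (hP : ∀ v ∈ P, C v = k) {v : V} (hv : C v = i) (hdeg : G.degree v < 6)
    (hne : v ∉ enclosed C k i P) {u w : V} (hu : u ∈ P) (hw : w ∈ P) (hvu : G.Adj v u)
    (hvw : G.Adj v w) : u = w := by
  obtain ⟨s, s', hs⟩ := exists_forall_adj_color hR C hdeg k
  obtain ⟨z, hvz, hz, hzP⟩ : ∃ z, G.Adj v z ∧ C z = k ∧ z ∉ P := by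
    by_contra h
    push Not at h
    exact hne ⟨hv, hdeg, h⟩
  have hzu : u ≠ z := fun e => hzP (e ▸ hu)
  have hzw : w ≠ z := fun e => hzP (e ▸ hw)
  exact eq_of_mem_pair (hs u hvu (hP u hu)) (hs w hvw (hP w hw)) (hs z hvz hz) hzu hzw

/-- Small vertices that are not enclosed by `P` are leaves over the forest spanned by `P` and the big
vertices of their colour. -/
theorem isAcyclic_inside_union_class
    (hR : ∀ d : G.Dart, R.facePerm (R.facePerm (R.facePerm d)) = d) {P : Set V}
    (hP : ∀ v ∈ P, C v = k) (h : (G.inside (P ∪ bigVertices C i)).IsAcyclic) :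
    (G.inside (P ∪ {v | C v = i ∧ v ∉ enclosed C k i P})).IsAcyclic := by
  refine (h.inside_union_leaves {v | (C v = i ∧ G.degree v < 6) ∧ v ∉ enclosed C k i P} ?_).inside_anti
    ?_
  · rintro l ⟨⟨hl, hd⟩, hne⟩ u w hu hw hlu hlw
    have hmem : ∀ u, u ∈ P ∪ bigVertices C i ∪
        {v | (C v = i ∧ G.degree v < 6) ∧ v ∉ enclosed C k i P} → G.Adj l u → u ∈ P := by
      rintro u ((hu | hu) | hu) e
      · exact hu
      · exact absurd (hl.trans hu.1.symm) (C.valid e)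
      · exact absurd (hl.trans hu.1.1.symm) (C.valid e)
    exact subsingleton_adj_of_notMem_enclosed hR hP hl hd hne (hmem u hu hlu) (hmem w hw hlw)
      hlu hlw
  · rintro v (hv | ⟨hv, hne⟩)
    · exact Or.inl (Or.inl hv)
    · by_cases hd : G.degree v < 6
      · exact Or.inr ⟨⟨hv, hd⟩, hne⟩
      · exact Or.inl (Or.inr ⟨hv, not_lt.1 hd⟩)

/-- The general construction of tree partitions. Colour `i` goes to the first tree and colour `j` to
the second one, except that `D`, a set of vertices of colour `i`, is moved to the second tree. The
sets `P` and `Q` of vertices of colour `k` go to the first and the second tree. What remains are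
small vertices, whose tree is not prescribed: the other vertices of colour `k`, and sets `Wi`, `Wj`
of vertices enclosed by `P` and `Q`. -/
theorem IsPlaneTriangulation.exists_of_classes (hR : R.IsPlaneTriangulation) (hki : k ≠ i)
    (hkj : k ≠ j) (hij : i ≠ j) {P Q D Wi Wj : Set V} (hP : ∀ v ∈ P, C v = k)
    (hQ : ∀ v ∈ Q, C v = k) (hPQ : Disjoint P Q) (hbig : bigVertices C k ⊆ P ∪ Q)
    (hD : ∀ v ∈ D, C v = i) (hDP : ∀ c ∈ D, ∀ x, G.Adj c x → C x = k → x ∈ P)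
    (hWi : Wi ⊆ enclosed C k i P) (hWj : Wj ⊆ enclosed C k j Q)
    (hS : (G.inside (P ∪ {v | C v = i ∧ v ∉ D ∧ v ∉ Wi})).IsAcyclic)
    (hT : (G.inside (Q ∪ D ∪ {v | C v = j ∧ v ∉ Wj})).IsAcyclic) :
    ∃ S T, IsTreePartition G S T ∧ P ⊆ S ∧ {v | C v = i ∧ v ∉ D ∧ v ∉ Wi} ⊆ S ∧
      Q ⊆ T ∧ D ⊆ T ∧ {v | C v = j ∧ v ∉ Wj} ⊆ T := by
  have htri := hR.2
  have hdis : Disjoint (P ∪ {v | C v = i ∧ v ∉ D ∧ v ∉ Wi})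
      (Q ∪ D ∪ {v | C v = j ∧ v ∉ Wj}) := by
    rw [Set.disjoint_left]
    rintro v (hv | ⟨hv, hvD, -⟩) ((hv' | hv') | ⟨hv', -⟩)
    · exact Set.disjoint_left.1 hPQ hv hv'
    · exact hki ((hP v hv).symm.trans (hD v hv'))
    · exact hkj ((hP v hv).symm.trans hv')
    · exact hki ((hQ v hv').symm.trans hv)
    · exact hvD hv'
    · exact hij (hv.symm.trans hv')
  -- a face has one corner of each colour
  have hface : ∀ x y z, C x = k → C y = i → C z = j → G.Adj x y → G.Adj y z → G.Adj x z →
      ((x ∈ P ∪ {v | C v = i ∧ v ∉ D ∧ v ∉ Wi} ∨ y ∈ P ∪ {v | C v = i ∧ v ∉ D ∧ v ∉ Wi}) ∧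
      (x ∈ Q ∪ D ∪ {v | C v = j ∧ v ∉ Wj} ∨ y ∈ Q ∪ D ∪ {v | C v = j ∧ v ∉ Wj} ∨
        z ∈ Q ∪ D ∪ {v | C v = j ∧ v ∉ Wj})) := by
    intro x y z hx hy hz hxy hyz hxz
    constructor
    · by_cases h1 : y ∈ D
      · exact Or.inl (Or.inl (hDP y h1 x hxy.symm hx))
      by_cases h2 : y ∈ Wi
      · exact Or.inl (Or.inl ((hWi h2).2.2 x hxy.symm hx))
      · exact Or.inr (Or.inr ⟨hy, h1, h2⟩)
    · by_cases h2 : z ∈ Wj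
      · exact Or.inl (Or.inl (Or.inl ((hWj h2).2.2 x hxz.symm hx)))
      · exact Or.inr (Or.inr (Or.inr ⟨hz, h2⟩))
  have hfaces : R.MeetsFaces (P ∪ {v | C v = i ∧ v ∉ D ∧ v ∉ Wi}) ∧
      R.MeetsFaces (Q ∪ D ∪ {v | C v = j ∧ v ∉ Wj}) := by
    refine forall_and.1 fun v => forall_and.1 fun u => forall_and.1 fun w => ?_
    rw [← imp_and]
    intro h
    have hc := h.color_ne htri C
    have e1 := h.adj_left
    have e2 := h.adj_right
    have e3 := h.adj htri
    have f := fin_three_eq hki hkj hij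
    rcases f (C v) with hv | hv | hv <;> rcases f (C u) with hu | hu | hu <;>
      rcases f (C w) with hw | hw | hw
    all_goals first
      | exact absurd (hv.trans hu.symm) hc.1
      | exact absurd (hv.trans hw.symm) hc.2.1
      | exact absurd (hu.trans hw.symm) hc.2.2
      | skip
    · have := hface v u w hv hu hw e1 e3 e2; tauto
    · have := hface v w u hv hw hu e2 e3.symm e1; tauto
    · have := hface u v w hu hv hw e1.symm e2 e3; tauto
    · have := hface w v u hw hv hu e2.symm e1 e3.symm; tauto
    · have := hface u w v hu hw hv e3 e2.symm e1.symm; tauto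
    · have := hface w u v hw hu hv e3.symm e1.symm e2.symm; tauto
  obtain ⟨S, hsub, hdisS, htree⟩ := hR.exists_isTreePartition hdis hS hT hfaces.1 hfaces.2 (by
    intro f hfS hfT
    rcases fin_three_eq hki hkj hij (C f) with hf | hf | hf
    · have hd : G.degree f < 6 := by
        by_contra hd
        rcases hbig ⟨hf, not_lt.1 hd⟩ with h | h
        · exact hfS (Or.inl h)
        · exact hfT (Or.inl (Or.inl h))
      obtain ⟨s, s', hs⟩ := exists_forall_adj_color htri C hd i
      refine ⟨s, s', ?_⟩
      rintro x (hx | ⟨hx, -⟩) e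
      · exact absurd (hf.trans (hP x hx).symm) (C.valid e)
      · exact hs x e hx
    · have hW : f ∈ Wi := by
        by_contra hW
        exact hfS (Or.inr ⟨hf, fun h => hfT (Or.inl (Or.inr h)), hW⟩)
      obtain ⟨s, s', hs⟩ := exists_forall_adj_color htri C (hWi hW).2.1 k
      refine ⟨s, s', ?_⟩
      rintro x (hx | ⟨hx, -⟩) e
      · exact hs x e (hP x hx)
      · exact absurd (hf.trans hx.symm) (C.valid e)
    · have hW : f ∈ Wj := by
        by_contra hW
        exact hfT (Or.inr ⟨hf, hW⟩)
      obtain ⟨s, s', hs⟩ := exists_forall_adj_color htri C (hWj hW).2.1 i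
      refine ⟨s, s', ?_⟩
      rintro x (hx | ⟨hx, -⟩) e
      · exact absurd ((hWj hW).2.2 x e (hP x hx)) (Set.disjoint_left.1 hPQ hx)
      · exact hs x e hx)
  have hsub' : Q ∪ D ∪ {v | C v = j ∧ v ∉ Wj} ⊆ Sᶜ :=
    fun x hx hxS => Set.disjoint_left.1 hdisS hxS hx
  exact ⟨S, Sᶜ, htree, fun x h => hsub (Or.inl h), fun x h => hsub (Or.inr h),
    fun x h => hsub' (Or.inl (Or.inl h)), fun x h => hsub' (Or.inl (Or.inr h)),
    fun x h => hsub' (Or.inr h)⟩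

/-- Move one vertex `c` of colour `i` to the tree of colour `j`, all of whose edges are then at `c` or
at the prescribed set `D` of small vertices. -/
theorem IsPlaneTriangulation.exists_move (hR : R.IsPlaneTriangulation) (hki : k ≠ i)
    (hkj : k ≠ j) (hij : i ≠ j) (hac : (G.inside (bigVertices C k ∪ bigVertices C i)).IsAcyclic)
    {c : V} (hc : C c = i) {D : Set V} (hD : ∀ v ∈ D, C v = k ∧ G.degree v < 6 ∧ ¬ G.Adj c v)
    (hT : (G.inside (D ∪ {c} ∪ {v | C v = j})).IsAcyclic) :
    ∃ S T, IsTreePartition G S T ∧ bigVertices C k ⊆ S ∧ (∀ v, C v = k → G.Adj c v → v ∈ S) ∧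
      {v | C v = i ∧ v ≠ c ∧ v ∉ enclosed C k i (bigVertices C k)} ⊆ S ∧ D ⊆ T ∧ c ∈ T ∧
      {v | C v = j} ⊆ T := by
  have hbk : ∀ v ∈ bigVertices C k, C v = k := fun v hv => hv.1
  have h1 := (isAcyclic_inside_union_class hR.2 hbk hac).inside_anti
    (S := bigVertices C k ∪ {v | C v = i ∧ v ∉ ({c} : Set V) ∧ v ∉ enclosed C k i (bigVertices C k)})
    (Set.union_subset_union_right _ fun v hv => ⟨hv.1, hv.2.2⟩)
  obtain ⟨S, T, h, h1, h2, h3, h4, h5⟩ := hR.exists_of_classes hki hkj hij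
    (P := bigVertices C k ∪ {v | C v = k ∧ G.Adj c v}) (Q := D) (D := {c})
    (Wi := enclosed C k i (bigVertices C k)) (Wj := ∅)
    (by rintro v (hv | hv) <;> exact hv.1) (fun v hv => (hD v hv).1)
    (by
      rw [Set.disjoint_left]
      rintro v (hv | hv) hv'
      · exact absurd hv.2 (not_le.2 (hD v hv').2.1)
      · exact (hD v hv').2.2 hv.2)
    (fun v hv => Or.inl (Or.inl hv)) (by rintro v rfl; exact hc)
    (by rintro v rfl x e hx; exact Or.inr ⟨hx, e⟩)
    (enclosed_mono Set.subset_union_left) (Set.empty_subset _)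
    (by
      -- the neighbours of `c` lost one of their two neighbours of colour `i`
      refine (h1.inside_union_leaves {v | (C v = k ∧ G.degree v < 6) ∧ G.Adj c v} ?_).inside_anti ?_
      · rintro l ⟨⟨hl, hd⟩, hcl⟩ u w hu hw hlu hlw
        have hmem : ∀ u, u ∈ bigVertices C k ∪ {v | C v = i ∧ v ∉ ({c} : Set V) ∧
            v ∉ enclosed C k i (bigVertices C k)} ∪ {v | (C v = k ∧ G.degree v < 6) ∧ G.Adj c v} →
            G.Adj l u → C u = i ∧ u ≠ c := by
          rintro u ((hu | hu) | hu) e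
          · exact absurd (hl.trans hu.1.symm) (C.valid e)
          · exact ⟨hu.1, hu.2.1⟩
          · exact absurd (hl.trans hu.1.1.symm) (C.valid e)
        obtain ⟨s, s', hs⟩ := exists_forall_adj_color hR.2 C hd i
        have a1 := hmem u hu hlu
        have a2 := hmem w hw hlw
        exact eq_of_mem_pair (hs u hlu a1.1) (hs w hlw a2.1) (hs c hcl.symm hc) a1.2 a2.2
      · rintro v ((hv | hv) | hv)
        · exact Or.inl (Or.inl hv)
        · by_cases hd : G.degree v < 6
          · exact Or.inr ⟨⟨hv.1, hd⟩, hv.2⟩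
          · exact Or.inl (Or.inl ⟨hv.1, not_lt.1 hd⟩)
        · exact Or.inl (Or.inr hv))
    (by simpa using hT)
  exact ⟨S, T, h, fun v hv => h1 (Or.inl hv), fun v hv e => h1 (Or.inr ⟨hv, e⟩),
    fun v hv => h2 ⟨hv.1, hv.2.1, hv.2.2⟩, h3, h4 rfl, fun v hv => h5 ⟨hv, by simp⟩⟩

/-- A small vertex `a` of colour `i` all of whose neighbours of colour `k` are big can be put into the
tree of colour `k` as a link between two of its components, while all other vertices of colour `i`
are in the other tree. -/
theorem IsPlaneTriangulation.exists_connect (hR : R.IsPlaneTriangulation)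
    (h2 : R.NoDegreeTwo) (hki : k ≠ i) (hkj : k ≠ j) (hij : i ≠ j)
    (hac : (G.inside (bigVertices C k ∪ bigVertices C j)).IsAcyclic)
    {a b : V} (ha : a ∈ enclosed C k i (bigVertices C k)) (hab : G.Adj a b) (hb : C b = k) :
    ∃ S T, IsTreePartition G S T ∧ a ∈ S ∧ bigVertices C k ⊆ S ∧
      {v | C v = i ∧ v ≠ a} ⊆ T ∧ (∀ v, C v = j → G.Adj a v → v ∈ T) := by
  obtain ⟨hai, had, haB⟩ := ha
  obtain ⟨q, x, x', hl, -⟩ := exists_isColoredLink hR.2 h2 C had hab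
  have hx : C x = j := fin_three_third hki.symm (by rw [← hai]; exact hl.color_ne_x.symm)
    (by rw [← hb]; exact hl.color_ne.symm) hij.symm hkj.symm
  have hx' : C x' = j := hl.color_y.trans hx
  have hq : C q = k := hl.color_b'.trans hb
  have hbB := haB b hab hb
  have hqB := haB q hl.adj_b' hq
  -- `E` contains at most one vertex, whose removal separates `b` from `q`
  obtain ⟨E, hE, hEac, hEsep⟩ : ∃ E : Set V, (∀ e ∈ E, C e = j) ∧
      (G.inside (E ∪ {v | C v = i})).IsAcyclic ∧
      ¬ (G.inside (bigVertices C k ∪ (bigVertices C j \ E))).Reachable b q := by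
    by_cases hr : (G.inside (bigVertices C k ∪ bigVertices C j)).Reachable b q
    · obtain ⟨y, hy, hsep⟩ := hac.exists_adj_not_reachable hl.ne hr
      have hyj : C y = j := by
        rcases hy.2.2 with h | h
        · exact absurd (hb.trans h.1.symm) (C.valid hy.1)
        · exact h.1
      refine ⟨{y}, by rintro e rfl; exact hyj, ?_, fun h => hsep (h.mono ?_)⟩
      · exact isAcyclic_inside_singleton_union C i y
      · apply SimpleGraph.inside_mono
        rintro v (hv | hv)
        · exact ⟨Or.inl hv, fun e => hkj (hv.1.symm.trans ((congrArg C e).trans hyj))⟩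
        · exact ⟨Or.inr hv.1, hv.2⟩
    · refine ⟨∅, by simp, ?_, by simpa using hr⟩
      simpa using isAcyclic_inside_class C i
  have hsmall : ∀ z, C z = j → G.Adj b z → G.Adj q z → z ∉ E → G.degree z < 6 := by
    intro z hz hbz hqz hzE
    by_contra hd
    have hzB : z ∈ bigVertices C k ∪ (bigVertices C j \ E) := Or.inr ⟨⟨hz, not_lt.1 hd⟩, hzE⟩
    have e1 : (G.inside (bigVertices C k ∪ (bigVertices C j \ E))).Adj b z :=
      ⟨hbz, Or.inl hbB, hzB⟩
    have e2 : (G.inside (bigVertices C k ∪ (bigVertices C j \ E))).Adj z q :=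
      ⟨hqz.symm, hzB, Or.inl hqB⟩
    exact hEsep (e1.reachable.trans e2.reachable)
  have hxs : ∀ z, z = x ∨ z = x' → C z = j ∧ G.Adj a z ∧ (z ∉ E → G.degree z < 6) := by
    rintro z (rfl | rfl)
    · exact ⟨hx, hl.adj_x, hsmall _ hx hl.adj_bx hl.adj_b'x⟩
    · exact ⟨hx', hl.adj_y, hsmall _ hx' hl.adj_by hl.adj_b'y⟩
  have hax : ∀ z, G.Adj a z → C z = j → z = x ∨ z = x' :=
    fun z e hz => hl.eq_of_adj' z e (hz.trans hx.symm)
  have hP : ∀ v ∈ E ∪ {v | v = x ∨ v = x'}, C v = j := by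
    rintro v (hv | hv)
    · exact hE v hv
    · exact (hxs v hv).1
  set Q : Set V := bigVertices C j \ (E ∪ {v | v = x ∨ v = x'}) with hQdef
  have hQ : ∀ v ∈ Q, C v = j := fun v hv => hv.1.1
  have haQB : (G.inside (insert a (Q ∪ bigVertices C k))).IsAcyclic := by
    refine (hac.inside_anti ?_).inside_insert ?_ ?_
    · rintro v (hv | hv)
      · exact Or.inr hv.1
      · exact Or.inl hv
    · rintro (h | h)
      · exact hij (hai.symm.trans (hQ a h))
      · exact hki (h.1.symm.trans hai)
    · have hbq : ∀ u, u ∈ Q ∪ bigVertices C k → G.Adj a u → u = b ∨ u = q := by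
        rintro u (hu | hu) e
        · exact absurd (Or.inr (hax u e (hQ u hu))) hu.2
        · exact hl.eq_of_adj u e (hu.1.trans hb.symm)
      have hle : G.inside (Q ∪ bigVertices C k) ≤
          G.inside (bigVertices C k ∪ (bigVertices C j \ E)) := by
        apply SimpleGraph.inside_mono
        rintro v (hv | hv)
        · exact Or.inr ⟨hv.1, fun h => hv.2 (Or.inl h)⟩
        · exact Or.inl hv
      intro u w hu hw hau haw hr
      have hr' := hr.mono hle
      rcases hbq u hu hau with rfl | rfl <;> rcases hbq w hw haw with rfl | rfl
      · rfl
      · exact absurd hr' hEsep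
      · exact absurd hr'.symm hEsep
      · rfl
  obtain ⟨S, T, h, h1, h2, h3, h4, h5⟩ := hR.exists_of_classes (k := j) (i := i) (j := k)
    hij.symm hkj.symm hki.symm (P := E ∪ {v | v = x ∨ v = x'}) (Q := Q) (D := {a}) (Wi := ∅)
    (Wj := enclosed C j k Q) hP hQ disjoint_sdiff_self_right
    (fun v hv => by
      by_cases hvP : v ∈ E ∪ {v | v = x ∨ v = x'}
      · exact Or.inl hvP
      · exact Or.inr ⟨hv, hvP⟩)
    (by rintro v rfl; exact hai) (by rintro v rfl z e hz; exact Or.inr (hax z e hz))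
    (Set.empty_subset _) (subset_refl _)
    (by
      refine ((hEac.inside_anti (S := E ∪ {v | C v = i ∧ v ≠ a}) (Set.union_subset_union_right _
        fun v hv => hv.1)).inside_union_leaves {v | (v = x ∨ v = x') ∧ v ∉ E} ?_).inside_anti ?_
      · rintro l ⟨hlx, hlE⟩ u w hu hw hlu hlw
        obtain ⟨hlj, hal, hld⟩ := hxs l hlx
        have hmem : ∀ u, u ∈ E ∪ {v | C v = i ∧ v ≠ a} ∪ {v | (v = x ∨ v = x') ∧ v ∉ E} →
            G.Adj l u → C u = i ∧ u ≠ a := by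
          rintro u ((hu | hu) | hu) e
          · exact absurd (hlj.trans (hE u hu).symm) (C.valid e)
          · exact hu
          · exact absurd (hlj.trans (hxs u hu.1).1.symm) (C.valid e)
        obtain ⟨s, s', hs⟩ := exists_forall_adj_color hR.2 C (hld hlE) i
        have a1 := hmem u hu hlu
        have a2 := hmem w hw hlw
        exact eq_of_mem_pair (hs u hlu a1.1) (hs w hlw a2.1) (hs a hal.symm hai) a1.2 a2.2
      · rintro v ((hv | hv) | hv)
        · exact Or.inl (Or.inl hv)
        · by_cases hvE : v ∈ E
          · exact Or.inl (Or.inl hvE)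
          · exact Or.inr ⟨hv, hvE⟩
        · exact Or.inl (Or.inr ⟨hv.1, hv.2.1⟩))
    (by
      refine (haQB.inside_union_leaves
        {v | (C v = k ∧ G.degree v < 6) ∧ v ∉ enclosed C j k Q} ?_).inside_anti ?_
      · rintro l ⟨⟨hlk, hld⟩, hle⟩ u w hu hw hlu hlw
        have hmem : ∀ u, u ∈ insert a (Q ∪ bigVertices C k) ∪
            {v | (C v = k ∧ G.degree v < 6) ∧ v ∉ enclosed C j k Q} → G.Adj l u → u ∈ Q := by
          rintro u ((rfl | hu | hu) | hu) e
          · exact absurd (haB l e.symm hlk).2 (not_le.2 hld)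
          · exact hu
          · exact absurd (hlk.trans hu.1.symm) (C.valid e)
          · exact absurd (hlk.trans hu.1.1.symm) (C.valid e)
        exact subsingleton_adj_of_notMem_enclosed hR.2 hQ hlk hld hle (hmem u hu hlu)
          (hmem w hw hlw) hlu hlw
      · rintro v ((hv | rfl) | hv)
        · exact Or.inl (Or.inr (Or.inl hv))
        · exact Or.inl (Or.inl rfl)
        · by_cases hd : G.degree v < 6
          · exact Or.inr ⟨⟨hv.1, hd⟩, hv.2⟩
          · exact Or.inl (Or.inr (Or.inr ⟨hv.1, not_lt.1 hd⟩)))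
  refine ⟨T, S, h.symm, h4 rfl, ?_, ?_, ?_⟩
  · exact fun v hv => h5 ⟨hv.1, fun h => absurd hv.2 (not_le.2 h.2.1)⟩
  · exact fun v hv => h2 ⟨hv.1, hv.2, by simp⟩
  · exact fun v hv e => h1 (Or.inr (hax v e hv))

end RotationSystem

/-! ### Triangles separate the plane -/

namespace RotationSystem

variable {V : Type*} {G : SimpleGraph V} {R : RotationSystem G}

/-- Mod `2`, each triangle of a plane graph is the boundary of a set of faces: there is a labelling
of the faces, given as a function on the darts along the face, that changes exactly across the edges
of the triangle. By Euler's formula the cycle space has the same dimension as the space of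
boundaries. -/
theorem IsPlane.exists_dart_label [Finite V] (hR : R.IsPlane) {b r p : V} (hbr : G.Adj b r)
    (hrp : G.Adj r p) (hpb : G.Adj p b) :
    ∃ l : G.Dart → ZMod 2, (∀ d, l (R.facePerm d) = l d) ∧
      ∀ d : G.Dart,
        ((d.edge = s(b, r) ∨ d.edge = s(r, p) ∨ d.edge = s(p, b)) → l d + l d.symm = 1) ∧
        (¬ (d.edge = s(b, r) ∨ d.edge = s(r, p) ∨ d.edge = s(p, b)) → l d + l d.symm = 0) := by
  classical
  have := Fintype.ofFinite V
  obtain ⟨hG, heuler⟩ := hR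
  have hFin : Finite R.Face := Quotient.finite _
  have := Fintype.ofFinite R.Face
  let mk : G.Dart → R.Face := fun d => Quotient.mk (Equiv.Perm.SameCycle.setoid R.facePerm) d
  have hmk : ∀ d, mk (R.facePerm d) = mk d := fun d => Quotient.sound ⟨-1, by simp⟩
  have hrep : ∀ e : G.edgeSet, ∃ d : G.Dart, d.edge = e.1 := by
    rintro ⟨e, he⟩
    induction e using Sym2.ind with
    | _ u v => exact ⟨⟨(u, v), he⟩, rfl⟩
  choose rep hrep using hrep
  have hsum : ∀ (f : R.Face → ZMod 2) (d : G.Dart) (e : G.edgeSet), d.edge = e.1 →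
      f (mk (rep e)) + f (mk (rep e).symm) = f (mk d) + f (mk d.symm) := by
    intro f d e h
    rcases SimpleGraph.dart_edge_eq_iff _ _ |>.1 ((hrep e).trans h.symm) with h | h
    · rw [h]
    · rw [h, SimpleGraph.Dart.symm_symm, add_comm]
  -- `D` takes a set of faces to its boundary, and `M` is the incidence matrix of the graph, so the
  -- kernel of `M` is the cycle space
  let D : (R.Face → ZMod 2) →ₗ[ZMod 2] (G.edgeSet → ZMod 2) :=
    { toFun := fun f e => f (mk (rep e)) + f (mk (rep e).symm)
      map_add' := fun f g => by ext e; simp only [Pi.add_apply]; ring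
      map_smul' := fun c f => by ext e; simp only [Pi.smul_apply, smul_eq_mul, RingHom.id_apply]; ring }
  obtain ⟨M, hM⟩ : ∃ M : Matrix V G.edgeSet (ZMod 2), ∀ v e, M v e = if v ∈ e.1 then 1 else 0 :=
    ⟨Matrix.of fun v e => if v ∈ e.1 then 1 else 0, fun _ _ => rfl⟩
  have hle : LinearMap.range D ≤ LinearMap.ker M.mulVecLin := by
    rintro _ ⟨f, rfl⟩
    rw [LinearMap.mem_ker]
    ext v
    have h1 : ∑ e : G.edgeSet, M v e * D f e =
        ∑ d : {d : G.Dart // d.fst = v}, (f (mk d.1) + f (mk d.1.symm)) := by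
      have : ∑ e : G.edgeSet, M v e * D f e =
          ∑ e ∈ Finset.univ.filter (fun e : G.edgeSet => v ∈ e.1), D f e := by
        rw [Finset.sum_filter]
        refine Finset.sum_congr rfl fun e _ => ?_
        by_cases h : v ∈ e.1 <;> simp [hM, h]
      rw [this]
      symm
      refine Finset.sum_bij (fun d _ => ⟨d.1.edge, d.1.edge_mem⟩) ?_ ?_ ?_ ?_
      · rintro ⟨d, rfl⟩ -
        rw [Finset.mem_filter]
        exact ⟨Finset.mem_univ _, Sym2.mem_mk_left _ _⟩
      · rintro ⟨d, hd⟩ - ⟨e, he⟩ - h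
        rw [Subtype.mk.injEq] at h ⊢
        rcases (SimpleGraph.dart_edge_eq_iff _ _).1 h with h | h
        · exact h
        · exfalso
          have hd' : d.fst = e.snd := congrArg (fun d : G.Dart => d.fst) h
          exact e.adj.ne (he.trans (hd.symm.trans hd'))
      · rintro ⟨e, he⟩ hv
        rw [Finset.mem_filter] at hv
        obtain ⟨w, rfl⟩ := Sym2.mem_iff_exists.1 hv.2
        exact ⟨⟨⟨(v, w), he⟩, rfl⟩, Finset.mem_univ _, rfl⟩
      · rintro d -
        exact (hsum f d.1 _ rfl).symm
    have h2 : ∑ d : {d : G.Dart // d.fst = v}, f (mk d.1.symm) =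
        ∑ d : {d : G.Dart // d.fst = v}, f (mk d.1) := by
      have hrot : ∀ d, d.fst = v ↔ (R.rot d).fst = v := fun d => by rw [R.fst_rot]
      rw [← Equiv.sum_comp (R.rot.subtypeEquiv hrot) (fun d => f (mk d.1))]
      refine Finset.sum_congr rfl fun d _ => ?_
      rw [← hmk, facePerm_apply, SimpleGraph.Dart.symm_symm]
      rfl
    change ∑ e : G.edgeSet, M v e * D f e = 0
    rw [h1, Finset.sum_add_distrib, h2, CharTwo.add_self_eq_zero]
  -- a function on the faces with zero boundary is constant
  have hkerD : Module.finrank (ZMod 2) (LinearMap.ker D) ≤ 1 := by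
    refine finrank_le_one ⟨fun _ => 1, ?_⟩ ?_
    · rw [LinearMap.mem_ker]
      ext e
      exact CharTwo.add_self_eq_zero _
    · rintro ⟨f, hf⟩
      have hsymm : ∀ d, f (mk d.symm) = f (mk d) := by
        intro d
        have := congrFun (LinearMap.mem_ker.1 hf) ⟨d.edge, d.edge_mem⟩
        have h3 : f (mk d) + f (mk d.symm) = 0 := (hsum f d _ rfl).symm.trans this
        exact (CharTwo.add_eq_zero.1 h3).symm
      have hrot : ∀ d, f (mk (R.rot d)) = f (mk d) := by
        intro d
        have := hmk d.symm
        rw [facePerm_apply, SimpleGraph.Dart.symm_symm] at this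
        rw [this, hsymm]
      have hstar : ∀ d e : G.Dart, d.fst = e.fst → f (mk d) = f (mk e) := by
        intro d e h
        obtain ⟨n, hn⟩ := (R.sameCycle_of_fst_eq d e h).exists_nat_pow_eq
        rw [← hn]
        clear hn h
        induction n with
        | zero => rfl
        | succ n ih => rw [pow_succ', Equiv.Perm.mul_apply, hrot, ← ih]
      have hall : ∀ d : G.Dart, f (mk d) = f (mk ⟨(b, r), hbr⟩) := by
        intro d
        have : d.fst ∈ {v | ∀ e : G.Dart, e.fst = v → f (mk e) = f (mk ⟨(b, r), hbr⟩)} := by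
          refine (hG.preconnected b d.fst).mem_of_closed ?_ (fun e he => hstar _ _ he)
          intro x y hx hxy e he
          rw [← hx ⟨(x, y), hxy⟩ rfl, ← hsymm ⟨(x, y), hxy⟩]
          exact hstar _ _ he
        exact this d rfl
      refine ⟨f (mk ⟨(b, r), hbr⟩), ?_⟩
      ext x
      induction x using Quotient.inductionOn with
      | h d =>
        change f (mk ⟨(b, r), hbr⟩) * 1 = f (mk d)
        rw [mul_one, hall d]
  -- a function on the vertices that agrees at the ends of each edge is constant
  have hkerM : Module.finrank (ZMod 2) (LinearMap.ker M.transpose.mulVecLin) ≤ 1 := by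
    have hcol : ∀ (f : V → ZMod 2) (u v : V) (h : G.Adj u v),
        M.transpose.mulVecLin f ⟨s(u, v), h⟩ = f u + f v := by
      intro f u v h
      change ∑ x, M x ⟨s(u, v), h⟩ * f x = f u + f v
      simp only [hM, Sym2.mem_iff, ite_mul, one_mul, zero_mul]
      have : (Finset.univ.filter fun x => x = u ∨ x = v) = {u, v} := by ext x; simp
      rw [← Finset.sum_filter, this, Finset.sum_pair h.ne]
    refine finrank_le_one ⟨fun _ => 1, ?_⟩ ?_
    · rw [LinearMap.mem_ker]
      ext ⟨e, he⟩
      induction e using Sym2.ind with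
      | _ u v => exact (hcol (fun _ => 1) u v he).trans (CharTwo.add_self_eq_zero _)
    · rintro ⟨f, hf⟩
      have hadj : ∀ u v, G.Adj u v → f u = f v := by
        intro u v h
        have := congrFun (LinearMap.mem_ker.1 hf) ⟨s(u, v), h⟩
        rw [hcol] at this
        exact CharTwo.add_eq_zero.1 this
      refine ⟨f b, ?_⟩
      ext v
      have : v ∈ {v | f b = f v} :=
        (hG.preconnected b v).mem_of_closed (fun x y hx hxy => hx.trans (hadj x y hxy)) rfl
      simpa using this
  -- boundaries are cycles, and the two dimensions agree by Euler's formula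
  have hrange : LinearMap.range D = LinearMap.ker M.mulVecLin := by
    refine Submodule.eq_of_le_of_finrank_le hle ?_
    have e1 := D.finrank_range_add_finrank_ker
    have e2 := M.mulVecLin.finrank_range_add_finrank_ker
    have e3 := M.transpose.mulVecLin.finrank_range_add_finrank_ker
    have e4 : Module.finrank (ZMod 2) (LinearMap.range M.transpose.mulVecLin) =
        Module.finrank (ZMod 2) (LinearMap.range M.mulVecLin) := M.rank_transpose
    rw [Module.finrank_fintype_fun_eq_card] at e1 e2 e3
    rw [Nat.card_eq_fintype_card, Nat.card_eq_fintype_card, Nat.card_eq_fintype_card] at heuler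
    omega
  obtain ⟨e₁, he₁⟩ : ∃ e : G.edgeSet, e.1 = s(b, r) := ⟨⟨_, hbr⟩, rfl⟩
  obtain ⟨e₂, he₂⟩ : ∃ e : G.edgeSet, e.1 = s(r, p) := ⟨⟨_, hrp⟩, rfl⟩
  obtain ⟨e₃, he₃⟩ : ∃ e : G.edgeSet, e.1 = s(p, b) := ⟨⟨_, hpb⟩, rfl⟩
  let z : G.edgeSet → ZMod 2 := Pi.single e₁ 1 + Pi.single e₂ 1 + Pi.single e₃ 1
  have hz : z ∈ LinearMap.range D := by
    rw [hrange, LinearMap.mem_ker, Matrix.mulVecLin_apply]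
    simp only [z, Matrix.mulVec_add, Matrix.mulVec_single_one]
    ext v
    simp only [Pi.add_apply, Matrix.col_apply, hM, he₁, he₂, he₃, Sym2.mem_iff, Pi.zero_apply]
    have h1 := hbr.ne
    have h2 := hrp.ne
    have h3 := hpb.ne
    by_cases hb : v = b
    · subst hb
      simp [h1, h3.symm, CharTwo.add_self_eq_zero]
    by_cases hr : v = r
    · subst hr
      simp [h1.symm, h2, CharTwo.add_self_eq_zero]
    by_cases hp : v = p
    · subst hp
      simp [h2.symm, h3, CharTwo.add_self_eq_zero]
    · simp [hb, hr, hp]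
  obtain ⟨f, hf⟩ := hz
  refine ⟨fun d => f (mk d), fun d => congrArg f (hmk d), fun d => ?_⟩
  have h1 := congrFun hf ⟨d.edge, d.edge_mem⟩
  have h2 : f (mk d) + f (mk d.symm) = z ⟨d.edge, d.edge_mem⟩ := (hsum f d _ rfl).symm.trans h1
  rw [h2]
  simp only [z, Pi.add_apply, Pi.single_apply, Subtype.ext_iff, he₁, he₂, he₃]
  have n1 : s(b, r) ≠ s(r, p) := by
    simp [hbr.ne, hpb.ne.symm]
  have n2 : s(b, r) ≠ s(p, b) := by
    simp [hpb.ne.symm, hrp.ne]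
  have n3 : s(r, p) ≠ s(p, b) := by
    simp [hrp.ne, hbr.ne.symm]
  constructor
  · rintro (c | c | c)
    · rw [if_pos c, if_neg (fun h => n1 (c.symm.trans h)), if_neg (fun h => n2 (c.symm.trans h))]
      rfl
    · rw [if_pos c, if_neg (fun h => n1 (h.symm.trans c)), if_neg (fun h => n3 (c.symm.trans h))]
      rfl
    · rw [if_pos c, if_neg (fun h => n2 (h.symm.trans c)), if_neg (fun h => n3 (h.symm.trans c))]
      rfl
  · intro c
    push Not at c
    rw [if_neg c.1, if_neg c.2.1, if_neg c.2.2]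
    rfl

/-- The labelling of the faces by the two sides of a triangle, read as a function `l v u` of the dart
from `v` to `u`. -/
theorem IsPlaneTriangulation.exists_label [Finite V] (hR : R.IsPlaneTriangulation) {b r p : V}
    (hbr : G.Adj b r) (hrp : G.Adj r p) (hpb : G.Adj p b) :
    ∃ l : V → V → ZMod 2, (∀ v u w, R.Follows v u w → l v w = l u v) ∧
      (∀ v, v ≠ b → v ≠ r → v ≠ p → ∀ u, G.Adj v u → l v u = l u v) ∧
      (∀ u, G.Adj b u → u ≠ r → u ≠ p → l b u = l u b) ∧ l b r = l r b + 1 ∧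
      l b p = l p b + 1 := by
  classical
  obtain ⟨l, h1, h2⟩ := hR.1.exists_dart_label hbr hrp hpb
  have key : ∀ u v (h : G.Adj u v),
      ((s(u, v) = s(b, r) ∨ s(u, v) = s(r, p) ∨ s(u, v) = s(p, b)) →
        l ⟨(u, v), h⟩ + l ⟨(v, u), h.symm⟩ = 1) ∧
      (¬ (s(u, v) = s(b, r) ∨ s(u, v) = s(r, p) ∨ s(u, v) = s(p, b)) →
        l ⟨(u, v), h⟩ + l ⟨(v, u), h.symm⟩ = 0) :=
    fun u v h => h2 ⟨(u, v), h⟩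
  refine ⟨fun u v => if h : G.Adj u v then l ⟨(u, v), h⟩ else 0, ?_, ?_, ?_, ?_, ?_⟩
  · intro v u w h
    have := h1 ⟨(u, v), h.adj_left.symm⟩
    rw [h.facePerm_eq] at this
    simpa [h.adj_right, h.adj_left.symm] using this
  · intro v hb hr hp u h
    have := (key v u h).2 (by simp [hb, hr, hp])
    simpa [h, h.symm] using CharTwo.add_eq_zero.1 this
  · intro u h hr hp
    have := (key b u h).2 (by simp [hr, hp, hbr.ne, hpb.ne.symm])
    simpa [h, h.symm] using CharTwo.add_eq_zero.1 this
  · have := (key b r hbr).1 (Or.inl rfl)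
    simp only [hbr, hbr.symm, dif_pos]
    rw [← this, add_comm (l ⟨(b, r), hbr⟩), ← add_assoc, CharTwo.add_self_eq_zero, zero_add]
  · have := (key b p hpb.symm).1 (Or.inr (Or.inr Sym2.eq_swap))
    simp only [hpb, hpb.symm, dif_pos]
    rw [← this, add_comm (l ⟨(b, p), hpb.symm⟩), ← add_assoc, CharTwo.add_self_eq_zero, zero_add]

/-- A consequence of planarity: let `r`, `c`, `s` be consecutive neighbours of `b`, and let `b` and
`p` be adjacent to each other and to `r`, `s`. If `b'` is adjacent to `r` and `s`, then `b` and `b'`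
have no common neighbour `a` besides these vertices. Otherwise `{b, r, s}` and `{c, p, b'}` would
span a subdivision of `K₃,₃`, the edge `bb'` being replaced by the path through `a`. The triangles
`brp` and `bsp` both have `a` and `c` on the same side, but in the rotation at `b` one of them has
to separate these two vertices. -/
theorem IsPlaneTriangulation.not_crossing [Finite V] (hR : R.IsPlaneTriangulation)
    {a b b' c r s p : V} (hrc : R.Follows b r c) (hcs : R.Follows b c s) (hrs : r ≠ s)
    (hbp : G.Adj b p) (hrp : G.Adj r p) (hsp : G.Adj s p) (hab : G.Adj a b) (hab' : G.Adj a b')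
    (hb'r : G.Adj b' r) (hb's : G.Adj b' s) (har : a ≠ r) (has : a ≠ s) (hap : a ≠ p)
    (hac : a ≠ c) (hcp : c ≠ p) (hb'b : b' ≠ b) (hb'p : b' ≠ p) : False := by
  have hcr := (hrc.adj hR.2).symm
  have hcs' := hcs.adj hR.2
  have hbr := hrc.adj_left
  have hbc := hcs.adj_left
  have hbs := hcs.adj_right
  -- for a triangle `btp`, the labels of the darts that leave a vertex off the triangle agree
  have same : ∀ {t : V} {l : V → V → ZMod 2},
      (∀ v u w, R.Follows v u w → l v w = l u v) →
      (∀ v, v ≠ b → v ≠ t → v ≠ p → ∀ u, G.Adj v u → l v u = l u v) →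
      ∀ {v u w}, v ≠ b → v ≠ t → v ≠ p → G.Adj v u → G.Adj v w → l v u = l v w := by
    intro t l h1 h2 v u w hb ht hp hu hw
    refine link_induction (R := R) (K := fun w => l v u = l v w) hu rfl ?_ hw
    intro x y hf hx
    rw [hx, h1 _ _ _ hf]
    exact h2 v hb ht hp x hf.adj_left
  -- the walk `c`, `t'`, `b'`, `a` avoids the triangle `btp`
  have walk : ∀ {t t' : V}, t' ≠ t → t' ≠ b → t' ≠ p → G.Adj c t' →
      G.Adj b' t' → b' ≠ t → a ≠ t → c ≠ t → ∀ {l : V → V → ZMod 2},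
      (∀ v u w, R.Follows v u w → l v w = l u v) →
      (∀ v, v ≠ b → v ≠ t → v ≠ p → ∀ u, G.Adj v u → l v u = l u v) →
      l b c = l b a := by
    intro t t' ht't ht'b ht'p hct' hb't' hb't hat hct l h1 h2
    have e1 := h2 c hbc.ne.symm hct hcp b hbc.symm
    have e2 := same h1 h2 hbc.ne.symm hct hcp hbc.symm hct'
    have e3 := h2 c hbc.ne.symm hct hcp t' hct'
    have e4 := same h1 h2 ht'b ht't ht'p hct'.symm hb't'.symm
    have e5 := h2 t' ht'b ht't ht'p b' hb't'.symm
    have e6 := same h1 h2 hb'b hb't hb'p hb't' hab'.symm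
    have e7 := h2 b' hb'b hb't hb'p a hab'.symm
    have e8 := same h1 h2 hab.ne hat hap hab' hab
    have e9 := h2 a hab.ne hat hap b hab
    rw [← e1, e2, e3, e4, e5, e6, e7, e8, e9]
  obtain ⟨l, l1, l2, l3, l4, l5⟩ := hR.exists_label hbr hrp hbp.symm
  obtain ⟨m, m1, m2, m3, m4, m5⟩ := hR.exists_label hbs hsp hbp.symm
  have el := walk hrs.symm hbs.ne.symm hsp.ne hcs' hb's hb'r.ne har hcr.ne l1 l2
  have em := walk hrs hbr.ne.symm hrp.ne hcr hb'r hb's.ne has hcs'.ne m1 m2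
  -- going around `b`, the sum of the two labels changes exactly at `r` and `s`
  have hstep : ∀ u w, R.Follows b u w → u ≠ r → u ≠ s → l b w + m b w = l b u + m b u := by
    intro u w hf hur hus
    rw [l1 _ _ _ hf, m1 _ _ _ hf]
    by_cases hup : u = p
    · subst hup
      rw [l5, m5]
      linear_combination -(CharTwo.add_self_eq_zero (1 : ZMod 2))
    · rw [l3 u hf.adj_left hur hup, m3 u hf.adj_left hus hup]
  have hs' : ∀ w, R.Follows b s w → l b w + m b w = l b s + m b s + 1 := by
    intro w hf
    rw [l1 _ _ _ hf, m1 _ _ _ hf, l3 s hbs hrs.symm hsp.ne, m4]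
    linear_combination -(CharTwo.add_self_eq_zero (1 : ZMod 2))
  have hK : a = c ∨ a = s ∨ l b a + m b a = l b c + m b c + 1 := by
    refine link_induction (R := R)
      (K := fun a => a = c ∨ a = s ∨ l b a + m b a = l b c + m b c + 1) hbc (Or.inl rfl) ?_ hab.symm
    intro u w hf hu
    by_cases hur : u = r
    · subst hur
      exact Or.inl (hf.right_unique hrc)
    by_cases hus : u = s
    · subst hus
      exact Or.inr (Or.inr (by rw [hs' w hf, hstep c _ hcs hcr.ne hcs'.ne]))
    rcases hu with rfl | h | h
    · exact Or.inr (Or.inl (hf.right_unique hcs))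
    · exact absurd h hus
    · exact Or.inr (Or.inr (by rw [hstep u w hf hur hus, h]))
  rcases hK with h | h | h
  · exact hac h
  · exact has h
  · rw [el, em] at h
    exact one_ne_zero (add_eq_left.1 h.symm)

end RotationSystem

/-! ### Paths in the two trees -/

namespace RotationSystem

variable {V : Type*} [Fintype V] {G : SimpleGraph V} {R : RotationSystem G} {a b c : V}

/-- In a triangle, any edge and the opposite vertex are induced trees. -/
theorem exists_separating_of_triangle (hR : R.IsPlaneTriangulation) (C : G.Coloring (Fin 3))
    (hV : ∀ w, w = a ∨ w = b ∨ w = c) (hab : a ≠ b) (hac : a ≠ c) (hbc : b ≠ c) :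
    ∃ S T, IsTreePartition G S T ∧ a ∈ S ∧ b ∈ S ∧ c ∉ S := by
  obtain ⟨S, hsub, hd, h⟩ := hR.exists_isTreePartition (S₀ := {a, b}) (T₀ := {c})
    (by simp [hac.symm, hbc.symm])
    ((isAcyclic_inside_star C (C b) a).inside_anti (by
      rintro v (rfl | rfl)
      · exact Or.inl rfl
      · exact Or.inr rfl))
    ((isAcyclic_inside_class C (C c)).inside_anti (by rintro v rfl; exact rfl))
    (by
      intro v u w hf
      have h1 := hf.adj_left.ne
      have h2 := hf.adj_right.ne
      have h3 := (hf.adj hR.2).ne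
      simp only [Set.mem_insert_iff, Set.mem_singleton_iff]
      have := hV v; have := hV u; have := hV w
      grind)
    (by
      intro v u w hf
      have h1 := hf.adj_left.ne
      have h2 := hf.adj_right.ne
      have h3 := (hf.adj hR.2).ne
      simp only [Set.mem_singleton_iff]
      have := hV v; have := hV u; have := hV w
      grind)
    (by
      intro f hf hf'
      rcases hV f with rfl | rfl | rfl
      · exact absurd (Or.inl rfl) hf
      · exact absurd (Or.inr rfl) hf
      · exact absurd rfl hf')
  exact ⟨S, Sᶜ, h, hsub (Or.inl rfl), hsub (Or.inr rfl), fun hc =>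
    Set.disjoint_left.1 hd hc rfl⟩

variable [DecidableRel G.Adj] {C : G.Coloring (Fin 3)} {k i j : Fin 3}

/-- `exists_of_classes` without moved vertices. -/
theorem IsPlaneTriangulation.exists_of_classes' (hR : R.IsPlaneTriangulation) (hki : k ≠ i)
    (hkj : k ≠ j) (hij : i ≠ j) {P Q Wi Wj : Set V} (hP : ∀ v ∈ P, C v = k)
    (hQ : ∀ v ∈ Q, C v = k) (hPQ : Disjoint P Q) (hbig : bigVertices C k ⊆ P ∪ Q)
    (hWi : Wi ⊆ enclosed C k i P) (hWj : Wj ⊆ enclosed C k j Q)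
    (hS : (G.inside (P ∪ {v | C v = i ∧ v ∉ Wi})).IsAcyclic)
    (hT : (G.inside (Q ∪ {v | C v = j ∧ v ∉ Wj})).IsAcyclic) :
    ∃ S T, IsTreePartition G S T ∧ P ⊆ S ∧ (∀ v, C v = i → v ∉ Wi → v ∈ S) ∧
      Q ⊆ T ∧ (∀ v, C v = j → v ∉ Wj → v ∈ T) := by
  obtain ⟨S, T, h, h1, h2, h3, -, h5⟩ := hR.exists_of_classes hki hkj hij hP hQ hPQ hbig
    (D := ∅) (by simp) (by simp) hWi hWj (by simpa using hS) (by simpa using hT)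
  exact ⟨S, T, h, h1, fun v hv hW => h2 ⟨hv, by simp, hW⟩, h3, fun v hv hW => h5 ⟨hv, hW⟩⟩

/-- One vertex `b` of colour `k` is a star centre in the tree of colour `i`, and the big vertices of
colour `k` other than `b` are in the tree of colour `j`. -/
theorem IsPlaneTriangulation.exists_star (hR : R.IsPlaneTriangulation) (hki : k ≠ i)
    (hkj : k ≠ j) (hij : i ≠ j) (hac : (G.inside (bigVertices C k ∪ bigVertices C j)).IsAcyclic)
    (hb : C b = k) :
    ∃ S T, IsTreePartition G S T ∧ b ∈ S ∧ (∀ v, C v = i → v ∈ S) ∧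
      (∀ v ∈ bigVertices C k, v ≠ b → v ∈ T) ∧ (∀ v, C v = j → G.Adj b v → v ∈ T) := by
  have hQ : ∀ v ∈ bigVertices C k \ {b}, C v = k := fun v hv => hv.1.1
  obtain ⟨S, T, h, h1, h2, h3, h4⟩ := hR.exists_of_classes' hki hkj hij (C := C) (P := {b})
    (Q := bigVertices C k \ {b}) (Wi := ∅) (Wj := enclosed C k j (bigVertices C k \ {b}))
    (by rintro v rfl; exact hb) hQ disjoint_sdiff_self_right
    (by rw [Set.union_sdiff_self]; exact Set.subset_union_right)
    (Set.empty_subset _) (subset_refl _)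
    (by simpa using isAcyclic_inside_singleton_union C i b)
    (isAcyclic_inside_union_class hR.2 hQ
      (hac.inside_anti (Set.union_subset_union_left _ Set.sdiff_subset)))
  exact ⟨S, T, h, h1 rfl, fun v hv => h2 v hv (Set.notMem_empty v), fun v hv hne => h3 ⟨hv, hne⟩,
    fun v hv e => h4 v hv fun h => (h.2.2 b e.symm hb).2 rfl⟩

/-- `exists_move` without further vertices of colour `k` in the second tree. -/
theorem IsPlaneTriangulation.exists_move' (hR : R.IsPlaneTriangulation) (hki : k ≠ i)
    (hkj : k ≠ j) (hij : i ≠ j) (hac : (G.inside (bigVertices C k ∪ bigVertices C i)).IsAcyclic)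
    (hc : C c = i) :
    ∃ S T, IsTreePartition G S T ∧ bigVertices C k ⊆ S ∧ (∀ v, C v = k → G.Adj c v → v ∈ S) ∧
      (∀ v, C v = i → v ≠ c → v ∉ enclosed C k i (bigVertices C k) → v ∈ S) ∧ c ∈ T ∧
      (∀ v, C v = j → v ∈ T) := by
  obtain ⟨S, T, h, h1, h2, h3, -, h4, h5⟩ := hR.exists_move hki hkj hij hac hc (D := ∅) (by simp)
    (by simpa using isAcyclic_inside_star C j c)
  exact ⟨S, T, h, h1, h2, fun v hv hvc hve => h3 ⟨hv, hvc, hve⟩, h4, fun v hv => h5 hv⟩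

theorem notMem_enclosed_of_adj {v w : V} (hvw : G.Adj v w) (hw : C w = k)
    (hd : G.degree w < 6) : v ∉ enclosed C k i (bigVertices C k) :=
  fun h => absurd (h.2.2 w hvw hw).2 (not_le.2 hd)

theorem notMem_enclosed_of_mem_bigVertices {P : Set V} {v : V} {l : Fin 3}
    (hv : v ∈ bigVertices C l) : v ∉ enclosed C k i P :=
  fun h => absurd hv.2 (not_le.2 h.2.1)

/-- The names of this lemma and of the following ones list the colours of `a`, `b`, `c`, where `k` is the
colour whose big vertices span forests with those of each of the other two colours. -/
theorem exists_separating_kij (hR : R.IsPlaneTriangulation) (h2 : R.NoDegreeTwo) (hki : k ≠ i)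
    (hkj : k ≠ j) (hij : i ≠ j) (hi : (G.inside (bigVertices C k ∪ bigVertices C i)).IsAcyclic)
    (hj : (G.inside (bigVertices C k ∪ bigVertices C j)).IsAcyclic)
    (ha : C a = k) (hb : C b = i) (hc : C c = j) (hab : G.Adj a b) (hbc : G.Adj b c) :
    ∃ S T, IsTreePartition G S T ∧ a ∈ S ∧ b ∈ S ∧ c ∉ S := by
  by_cases had : G.degree a < 6
  · obtain ⟨b', x, y, hl, -⟩ := exists_isColoredLink hR.2 h2 C had hab
    obtain ⟨S, T, h, -, h1, h3, -, h4⟩ := hR.exists_move' hki hkj hij hi (hl.color_b'.trans hb)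
    exact ⟨S, T, h, h1 a ha hl.adj_b'.symm,
      h3 b hb hl.ne (notMem_enclosed_of_adj hab.symm ha had), h.notMem (h4 c hc)⟩
  have haB : a ∈ bigVertices C k := ⟨ha, not_lt.1 had⟩
  by_cases hbe : b ∈ enclosed C k i (bigVertices C k)
  · obtain ⟨a', x, y, hl, -⟩ := exists_isColoredLink hR.2 h2 C hbe.2.1 hab.symm
    have hac : G.Adj a c := by
      have hx : C x = C c := by
        rw [hc]
        exact fin_three_third hki (fun h => hl.color_ne (ha.trans h.symm))
          (fun h => hl.color_ne_x (hb.trans h.symm)) hkj.symm hij.symm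
      rcases hl.eq_of_adj' c hbc hx.symm with rfl | rfl
      · exact hl.adj_bx
      · exact hl.adj_by
    obtain ⟨S, T, h, h1, h3, -, h4⟩ := hR.exists_star hki hkj hij hj ha
    exact ⟨S, T, h, h1, h3 b hb, h.notMem (h4 c hc hac)⟩
  · obtain ⟨S, T, h, h1, h3, -, h4⟩ := hR.exists_of_classes' hki hkj hij (C := C)
      (P := bigVertices C k) (Q := ∅) (Wi := enclosed C k i (bigVertices C k)) (Wj := ∅)
      (fun v hv => hv.1) (by simp) (by simp) (by simp) (subset_refl _) (Set.empty_subset _)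
      (isAcyclic_inside_union_class hR.2 (fun v hv => hv.1) hi)
      (by simpa using isAcyclic_inside_class C j)
    exact ⟨S, T, h, h1 haB, h3 b hb hbe, h.notMem (h4 c hc (Set.notMem_empty c))⟩

theorem exists_separating_ikj (hR : R.IsPlaneTriangulation) (hki : k ≠ i)
    (hkj : k ≠ j) (hij : i ≠ j) (hj : (G.inside (bigVertices C k ∪ bigVertices C j)).IsAcyclic)
    (ha : C a = i) (hb : C b = k) (hc : C c = j) (hbc : G.Adj b c) :
    ∃ S T, IsTreePartition G S T ∧ a ∈ S ∧ b ∈ S ∧ c ∉ S := by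
  obtain ⟨S, T, h, h1, h2, -, h4⟩ := hR.exists_star hki hkj hij hj hb
  exact ⟨S, T, h, h2 a ha, h1, h.notMem (h4 c hc hbc)⟩

/-- The two ends of the path are small vertices of colour `k`. Let `b'` be the other neighbour of `a` of
colour `i`, and `r`, `s` the neighbours of `c` of colour `j`. If one of `b`, `b'`, `r`, `s` is small, then
`exists_move` applies to `c` or to `a`, with the colours exchanged. If the big vertices of the colours
`k` and `i` do not connect `b` with `b'`, then `a` can join all big vertices of colour `k` in one tree;
similarly for `c`, `r`, `s`. Otherwise a big vertex of colour `k` whose removal separates `r` from `s`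
can be exchanged for `c`, unless it is adjacent to both `b` and `b'`. There is at most one vertex of
this kind, so it is adjacent to `r` and `s`. Then `not_crossing` shows that `b'` is not adjacent to
both `r` and `s`, so that `b'` can be moved to the tree of colour `j` together with `c`. -/
theorem exists_separating_kik_of_small (hR : R.IsPlaneTriangulation) (h2 : R.NoDegreeTwo)
    (hki : k ≠ i) (hkj : k ≠ j) (hij : i ≠ j)
    (hi : (G.inside (bigVertices C k ∪ bigVertices C i)).IsAcyclic)
    (hj : (G.inside (bigVertices C k ∪ bigVertices C j)).IsAcyclic)
    (ha : C a = k) (hb : C b = i) (hc : C c = k) (hab : G.Adj a b) (hbc : G.Adj b c)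
    (hac : a ≠ c) (had : G.degree a < 6) (hcd : G.degree c < 6) :
    ∃ S T, IsTreePartition G S T ∧ a ∈ S ∧ b ∈ S ∧ c ∉ S := by
  have third : ∀ {x : V}, C x ≠ k → C x ≠ i → C x = j := fun h1 h2 =>
    fin_three_third hki h1 h2 hkj.symm hij.symm
  obtain ⟨b', _, _, hla, -⟩ := exists_isColoredLink hR.2 h2 C had hab
  obtain ⟨u, r, s, hlc, hlk⟩ := exists_isColoredLink hR.2 h2 C hcd hbc.symm
  have hb' : C b' = i := hla.color_b'.trans hb
  have hr : C r = j := third (hc ▸ hlc.color_ne_x.symm) (hb ▸ hlc.color_ne.symm)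
  have hs : C s = j := hlc.color_y.trans hr
  have aNb : ∀ v, G.Adj a v → C v = i → v = b ∨ v = b' :=
    fun v e hv => hla.eq_of_adj v e (hv.trans hb.symm)
  have cNr : ∀ v, G.Adj c v → C v = j → v = r ∨ v = s :=
    fun v e hv => hlc.eq_of_adj' v e (hv.trans hr.symm)
  by_cases hbb : b ∈ bigVertices C i ∧ b' ∈ bigVertices C i
  swap
  · obtain ⟨S, T, h, -, h1, h3, h4, -⟩ := hR.exists_move' hki.symm hij hkj
      (by rwa [Set.union_comm] at hi) hc
    exact ⟨S, T, h, h3 a ha hac fun he => hbb ⟨he.2.2 b hab hb, he.2.2 b' hla.adj_b' hb'⟩,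
      h1 b hb hbc.symm, h.notMem h4⟩
  by_cases hrs : r ∈ bigVertices C j ∧ s ∈ bigVertices C j
  swap
  · obtain ⟨S, T, h, -, -, h3, h4, h5⟩ := hR.exists_move' hkj.symm hij.symm hki
      (by rwa [Set.union_comm] at hj) ha
    exact ⟨T, S, h.symm, h4, h5 b hb, h.symm.notMem (h3 c hc hac.symm fun he =>
      hrs ⟨he.2.2 r hlc.adj_x hr, he.2.2 s hlc.adj_y hs⟩)⟩
  have haB : a ∉ bigVertices C k := fun h => absurd h.2 (not_le.2 had)
  have hcB : c ∉ bigVertices C k := fun h => absurd h.2 (not_le.2 hcd)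
  by_cases hr1 : (G.inside (bigVertices C k ∪ bigVertices C i)).Reachable b b'
  swap
  · have hP : ∀ v ∈ insert a (bigVertices C k), C v = k := by
      rintro v (rfl | hv)
      · exact ha
      · exact hv.1
    have hac' : (G.inside (insert a (bigVertices C k) ∪ bigVertices C i)).IsAcyclic := by
      rw [Set.insert_union]
      refine hi.inside_insert ?_ ?_
      · rintro (h | h)
        · exact haB h
        · exact hki (ha.symm.trans h.1)
      · have hN : ∀ v, v ∈ bigVertices C k ∪ bigVertices C i → G.Adj a v → v = b ∨ v = b' := by
          rintro v (hv | hv) e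
          · exact absurd (ha.trans hv.1.symm) (C.valid e)
          · exact aNb v e hv.1
        intro v w hv hw hav haw hreach
        rcases hN v hv hav with rfl | rfl <;> rcases hN w hw haw with rfl | rfl
        · rfl
        · exact absurd hreach hr1
        · exact absurd hreach.symm hr1
        · rfl
    obtain ⟨S, T, h, h1, h3, h4, -⟩ := hR.exists_of_classes' hki hkj hij (C := C)
      (P := insert a (bigVertices C k)) (Q := {c})
      (Wi := enclosed C k i (insert a (bigVertices C k))) (Wj := ∅) hP
      (by rintro v rfl; exact hc)
      (by
        rw [Set.disjoint_singleton_right]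
        rintro (h | h)
        · exact hac h.symm
        · exact hcB h)
      (fun v hv => Or.inl (Or.inr hv)) (subset_refl _) (Set.empty_subset _)
      (isAcyclic_inside_union_class hR.2 hP hac')
      (by simpa using isAcyclic_inside_star C j c)
    exact ⟨S, T, h, h1 (Set.mem_insert _ _),
      h3 b hb (notMem_enclosed_of_mem_bigVertices hbb.1), h.notMem (h4 rfl)⟩
  -- adding `c` to big vertices of colours `k` and `j` that do not connect `r` and `s`
  have haddc : ∀ U : Set V, U ⊆ bigVertices C k →
      ¬ (G.inside (U ∪ bigVertices C j)).Reachable r s →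
      (G.inside (insert c U ∪ bigVertices C j)).IsAcyclic := by
    intro U hU hsep
    rw [Set.insert_union]
    refine (hj.inside_anti (Set.union_subset_union_left _ hU)).inside_insert ?_ ?_
    · rintro (h | h)
      · exact hcB (hU h)
      · exact hkj (hc.symm.trans h.1)
    · have hN : ∀ v, v ∈ U ∪ bigVertices C j → G.Adj c v → v = r ∨ v = s := by
        rintro v (hv | hv) e
        · exact absurd (hc.trans (hU hv).1.symm) (C.valid e)
        · exact cNr v e hv.1
      intro v w hv hw hcv hcw hreach
      rcases hN v hv hcv with rfl | rfl <;> rcases hN w hw hcw with rfl | rfl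
      · rfl
      · exact absurd hreach hsep
      · exact absurd hreach.symm hsep
      · rfl
  have hcU : ∀ U : Set V, U ⊆ bigVertices C k → ∀ v ∈ insert c U, C v = k := by
    rintro U hU v (rfl | hv)
    · exact hc
    · exact (hU hv).1
  by_cases hr2 : (G.inside (bigVertices C k ∪ bigVertices C j)).Reachable r s
  swap
  · have hQ := hcU _ (subset_refl _)
    obtain ⟨S, T, h, h1, h3, h4, -⟩ := hR.exists_of_classes' hki hkj hij (C := C)
      (P := {a}) (Q := insert c (bigVertices C k)) (Wi := ∅)
      (Wj := enclosed C k j (insert c (bigVertices C k))) (by rintro v rfl; exact ha) hQ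
      (by
        rw [Set.disjoint_singleton_left]
        rintro (h | h)
        · exact hac h
        · exact haB h)
      (fun v hv => Or.inr (Or.inr hv)) (Set.empty_subset _) (subset_refl _)
      (by simpa using isAcyclic_inside_star C i a)
      (isAcyclic_inside_union_class hR.2 hQ (haddc _ (subset_refl _) hr2))
    exact ⟨S, T, h, h1 rfl, h3 b hb (Set.notMem_empty b), h.notMem (h4 (Set.mem_insert _ _))⟩
  -- a vertex whose removal separates `r` from `s` may be put into the other tree, unless it connects
  -- `b` and `b'`
  have hcut : ∀ x, x ∈ bigVertices C k →
      ¬ (G.inside ((bigVertices C k ∪ bigVertices C j) \ {x})).Reachable r s →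
      ¬ (G.Adj x b ∧ G.Adj x b') → ∃ S T, IsTreePartition G S T ∧ a ∈ S ∧ b ∈ S ∧ c ∉ S := by
    intro x hx hsep hxbb
    have hQ := hcU (bigVertices C k \ {x}) Set.sdiff_subset
    have hsep' : ¬ (G.inside (bigVertices C k \ {x} ∪ bigVertices C j)).Reachable r s := by
      refine fun h => hsep (h.mono (SimpleGraph.inside_mono ?_))
      rintro v (hv | hv)
      · exact ⟨Or.inl hv.1, hv.2⟩
      · refine ⟨Or.inr hv, ?_⟩
        rintro rfl
        exact hkj (hx.1.symm.trans hv.1)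
    obtain ⟨S, T, h, h1, h3, h4, -⟩ := hR.exists_of_classes' hki hkj hij (C := C)
      (P := {x, a}) (Q := insert c (bigVertices C k \ {x})) (Wi := ∅)
      (Wj := enclosed C k j (insert c (bigVertices C k \ {x})))
      (by
        rintro v (rfl | rfl)
        · exact hx.1
        · exact ha) hQ
      (by
        rw [Set.disjoint_left]
        rintro v (rfl | rfl) (h | h)
        · exact hcB (h ▸ hx)
        · exact h.2 rfl
        · exact hac h
        · exact haB h.1)
      (by
        intro v hv
        by_cases hvx : v = x
        · exact Or.inl (Or.inl hvx)
        · exact Or.inr (Or.inr ⟨hv, hvx⟩))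
      (Set.empty_subset _) (subset_refl _)
      (by
        have := isAcyclic_inside_two C i (x := a) (y := x)
          (fun e => C.valid e (ha.trans hx.1.symm)) (ha ▸ hki) (by
            intro v w hv hw hav haw hxv hxw
            rcases aNb v hav hv with rfl | rfl <;> rcases aNb w haw hw with rfl | rfl
            · rfl
            · exact absurd ⟨hxv, hxw⟩ hxbb
            · exact absurd ⟨hxw, hxv⟩ hxbb
            · rfl)
        simpa [Set.insert_union] using this)
      (isAcyclic_inside_union_class hR.2 hQ (haddc _ Set.sdiff_subset hsep'))
    exact ⟨S, T, h, h1 (Or.inr rfl), h3 b hb (Set.notMem_empty b),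
      h.notMem (h4 (Set.mem_insert _ _))⟩
  obtain ⟨p, hrp, hpsep⟩ := hj.exists_adj_not_reachable hlc.ne' hr2
  obtain ⟨p', hsp', hp'sep⟩ := hj.exists_adj_not_reachable hlc.ne'.symm hr2.symm
  have hk : ∀ {v w}, C v = j → (G.inside (bigVertices C k ∪ bigVertices C j)).Adj v w →
      w ∈ bigVertices C k := by
    rintro v w hv ⟨e, -, hw | hw⟩
    · exact hw
    · exact absurd (hv.trans hw.1.symm) (C.valid e)
  have hpB := hk hr hrp
  have hp'B := hk hs hsp'
  by_cases hpb : G.Adj p b ∧ G.Adj p b'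
  swap
  · exact hcut p hpB hpsep hpb
  by_cases hpb' : G.Adj p' b ∧ G.Adj p' b'
  swap
  · exact hcut p' hp'B (fun h => hp'sep h.symm) hpb'
  -- otherwise `p = p'`, as a forest contains no cycle of length four
  obtain rfl : p = p' := hi.not_four_cycle hla.ne ⟨hpb.1.symm, Or.inr hbb.1, Or.inl hpB⟩
    ⟨hpb.2, Or.inl hpB, Or.inr hbb.2⟩ ⟨hpb'.1.symm, Or.inr hbb.1, Or.inl hp'B⟩
    ⟨hpb'.2, Or.inl hp'B, Or.inr hbb.2⟩
  by_cases hb'rs : G.Adj b' r ∧ G.Adj b' s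
  · exact (hR.not_crossing (hlk.follows₁.rotate hR.2) ((hlk.follows₄.rotate hR.2).rotate hR.2)
      hlc.ne' hpb.1.symm hrp.1 hsp'.1 hab hla.adj_b' hb'rs.1 hb'rs.2
      (fun h => hkj (ha.symm.trans ((congrArg C h).trans hr)))
      (fun h => hkj (ha.symm.trans ((congrArg C h).trans hs)))
      (fun h => haB (h ▸ hpB)) hac (fun h => hcB (h ▸ hpB)) hla.ne.symm
      (fun h => hki (hpB.1.symm.trans ((congrArg C h.symm).trans hb')))).elim
  · have hb'c : ¬ G.Adj b' c := by
      intro e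
      rcases hlc.eq_of_adj b' e.symm (hb'.trans hb.symm) with h | h
      · exact hla.ne h.symm
      · subst h
        exact hb'rs ⟨hlc.adj_b'x, hlc.adj_b'y⟩
    obtain ⟨S, T, h, -, h1, h3, h4, -, -⟩ := hR.exists_move hki hkj hij hi hb' (D := {c})
      (by rintro v rfl; exact ⟨hc, hcd, hb'c⟩)
      (by
        have := isAcyclic_inside_two C j (x := b') (y := c) hb'c (hb' ▸ hij) (by
          intro v w hv hw hb'v hb'w hcv hcw
          rcases cNr v hcv hv with rfl | rfl <;> rcases cNr w hcw hw with rfl | rfl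
          · rfl
          · exact absurd ⟨hb'v, hb'w⟩ hb'rs
          · exact absurd ⟨hb'w, hb'v⟩ hb'rs
          · rfl)
        rw [Set.insert_comm] at this
        simpa [Set.insert_union] using this)
    exact ⟨S, T, h, h1 a ha hla.adj_b'.symm,
      h3 ⟨hb, hla.ne, notMem_enclosed_of_mem_bigVertices hbb.1⟩, h.notMem (h4 rfl)⟩

theorem exists_separating_kik (hR : R.IsPlaneTriangulation) (h2 : R.NoDegreeTwo)
    (hki : k ≠ i) (hkj : k ≠ j) (hij : i ≠ j)
    (hi : (G.inside (bigVertices C k ∪ bigVertices C i)).IsAcyclic)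
    (hj : (G.inside (bigVertices C k ∪ bigVertices C j)).IsAcyclic)
    (ha : C a = k) (hb : C b = i) (hc : C c = k) (hab : G.Adj a b) (hbc : G.Adj b c)
    (hac : a ≠ c) : ∃ S T, IsTreePartition G S T ∧ a ∈ S ∧ b ∈ S ∧ c ∉ S := by
  have hbig : ∀ v ∈ bigVertices C k, C v = k := fun v hv => hv.1
  by_cases hcd : G.degree c < 6
  · by_cases had : G.degree a < 6
    · exact exists_separating_kik_of_small hR h2 hki hkj hij hi hj ha hb hc hab hbc hac had hcd
    · obtain ⟨S, T, h, h1, h3, h4, -⟩ := hR.exists_of_classes' hki hkj hij (C := C)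
        (P := bigVertices C k) (Q := {c}) (Wi := enclosed C k i (bigVertices C k)) (Wj := ∅)
        hbig (by rintro v rfl; exact hc)
        (by
          rw [Set.disjoint_singleton_right]
          exact fun h => absurd h.2 (not_le.2 hcd))
        (fun v hv => Or.inl hv) (subset_refl _) (Set.empty_subset _)
        (isAcyclic_inside_union_class hR.2 hbig hi)
        (by simpa using isAcyclic_inside_star C j c)
      exact ⟨S, T, h, h1 ⟨ha, not_lt.1 had⟩, h3 b hb (notMem_enclosed_of_adj hbc hc hcd),
        h.notMem (h4 rfl)⟩
  · obtain ⟨S, T, h, h1, h3, h4, -⟩ := hR.exists_star hki hkj hij hj ha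
    exact ⟨S, T, h, h1, h3 b hb, h.notMem (h4 c ⟨hc, not_lt.1 hcd⟩ hac.symm)⟩

theorem exists_separating_iki (hR : R.IsPlaneTriangulation) (h2 : R.NoDegreeTwo)
    (hki : k ≠ i) (hkj : k ≠ j) (hij : i ≠ j)
    (hi : (G.inside (bigVertices C k ∪ bigVertices C i)).IsAcyclic)
    (hj : (G.inside (bigVertices C k ∪ bigVertices C j)).IsAcyclic)
    (ha : C a = i) (hb : C b = k) (hc : C c = i) (hab : G.Adj a b) (hbc : G.Adj b c)
    (hac : a ≠ c) : ∃ S T, IsTreePartition G S T ∧ a ∈ S ∧ b ∈ S ∧ c ∉ S := by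
  by_cases hae : a ∈ enclosed C k i (bigVertices C k)
  · obtain ⟨S, T, h, h1, h3, h4, -⟩ := hR.exists_connect h2 hki hkj hij hj hae hab hb
    exact ⟨S, T, h, h1, h3 (hae.2.2 b hab hb), h.notMem (h4 ⟨hc, hac.symm⟩)⟩
  · obtain ⟨S, T, h, -, h1, h3, h4, -⟩ := hR.exists_move' hki hkj hij hi hc
    exact ⟨S, T, h, h3 a ha hac hae, h1 b hb hbc.symm, h.notMem h4⟩

theorem exists_separating_iji (hR : R.IsPlaneTriangulation) (h2 : R.NoDegreeTwo)
    (hki : k ≠ i) (hkj : k ≠ j) (hij : i ≠ j)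
    (hi : (G.inside (bigVertices C k ∪ bigVertices C i)).IsAcyclic)
    (hj : (G.inside (bigVertices C k ∪ bigVertices C j)).IsAcyclic)
    (ha : C a = i) (hb : C b = j) (hc : C c = i) (hbc : G.Adj b c)
    (hac : a ≠ c) : ∃ S T, IsTreePartition G S T ∧ a ∈ S ∧ b ∈ S ∧ c ∉ S := by
  by_cases hce : c ∈ enclosed C k i (bigVertices C k)
  · obtain ⟨w, hw⟩ := exists_follows (R := R) hbc.symm
    have hcol := hw.color_ne hR.2 C
    have hwk : C w = k := fin_three_third hij (hc ▸ hcol.2.1.symm) (hb ▸ hcol.2.2.symm) hki hkj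
    obtain ⟨S, T, h, h1, -, h4, h5⟩ := hR.exists_connect h2 hki hkj hij hj hce hw.adj_right hwk
    exact ⟨T, S, h.symm, h4 ⟨ha, hac⟩, h5 b hb hbc.symm, h.symm.notMem h1⟩
  · obtain ⟨S, T, h, -, -, h3, h4, h5⟩ := hR.exists_move' hki hkj hij hi ha
    exact ⟨T, S, h.symm, h4, h5 b hb, h.symm.notMem (h3 c hc hac.symm hce)⟩

theorem exists_containing_kik (hR : R.IsPlaneTriangulation) (h2 : R.NoDegreeTwo)
    (hki : k ≠ i) (hkj : k ≠ j) (hij : i ≠ j)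
    (hi : (G.inside (bigVertices C k ∪ bigVertices C i)).IsAcyclic)
    (hj : (G.inside (bigVertices C k ∪ bigVertices C j)).IsAcyclic)
    (ha : C a = k) (hb : C b = i) (hc : C c = k) (hab : G.Adj a b) (hbc : G.Adj b c) :
    ∃ S T, IsTreePartition G S T ∧ a ∈ S ∧ b ∈ S ∧ c ∈ S := by
  have hbig : ∀ v ∈ bigVertices C k, C v = k := fun v hv => hv.1
  by_cases had : G.degree a < 6
  · obtain ⟨b', _, _, hla, -⟩ := exists_isColoredLink hR.2 h2 C had hab
    by_cases hcb' : G.Adj b' c ∨ c ∈ bigVertices C k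
    · obtain ⟨S, T, h, h1, h3, h4, -, -⟩ :=
        hR.exists_move' hki hkj hij hi (hla.color_b'.trans hb)
      refine ⟨S, T, h, h3 a ha hla.adj_b'.symm,
        h4 b hb hla.ne (notMem_enclosed_of_adj hab.symm ha had), ?_⟩
      rcases hcb' with e | hcB
      · exact h3 c hc e
      · exact h1 hcB
    · push Not at hcb'
      have haB : a ∉ bigVertices C k := fun h => absurd h.2 (not_le.2 had)
      obtain ⟨S, T, h, h1, h3, -, -⟩ := hR.exists_of_classes' hki hkj hij (C := C)
        (P := {c, a}) (Q := bigVertices C k) (Wi := ∅) (Wj := enclosed C k j (bigVertices C k))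
        (by
          rintro v (rfl | rfl)
          · exact hc
          · exact ha) hbig
        (by
          rw [Set.disjoint_left]
          rintro v (rfl | rfl)
          · exact hcb'.2
          · exact haB)
        (fun v hv => Or.inr hv) (Set.empty_subset _) (subset_refl _)
        (by
          have := isAcyclic_inside_two C i (x := a) (y := c)
            (fun e => C.valid e (ha.trans hc.symm)) (ha ▸ hki) (by
              have key : ∀ v, C v = i → G.Adj a v → G.Adj c v → v = b := by
                intro v hv hav hcv
                rcases hla.eq_of_adj v hav (hv.trans hb.symm) with rfl | rfl
                · rfl
                · exact absurd hcv.symm hcb'.1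
              intro v w hv hw hav haw hcv hcw
              rw [key v hv hav hcv, key w hw haw hcw])
          simpa [Set.insert_union] using this)
        (isAcyclic_inside_union_class hR.2 hbig hj)
      exact ⟨S, T, h, h1 (Or.inr rfl), h3 b hb (Set.notMem_empty b), h1 (Or.inl rfl)⟩
  · have haB : a ∈ bigVertices C k := ⟨ha, not_lt.1 had⟩
    by_cases hcd : G.degree c < 6
    · obtain ⟨b', _, _, hlc, -⟩ := exists_isColoredLink hR.2 h2 C hcd hbc.symm
      obtain ⟨S, T, h, h1, h3, h4, -, -⟩ :=
        hR.exists_move' hki hkj hij hi (hlc.color_b'.trans hb)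
      exact ⟨S, T, h, h1 haB, h4 b hb hlc.ne (notMem_enclosed_of_adj hbc hc hcd),
        h3 c hc hlc.adj_b'.symm⟩
    · have hcB : c ∈ bigVertices C k := ⟨hc, not_lt.1 hcd⟩
      by_cases hbe : b ∈ enclosed C k i (bigVertices C k)
      · obtain ⟨S, T, h, h1, h3, -, -⟩ := hR.exists_connect h2 hki hkj hij hj hbe hbc hc
        exact ⟨S, T, h, h3 haB, h1, h3 hcB⟩
      · obtain ⟨S, T, h, h1, h3, -, -⟩ := hR.exists_of_classes' hki hkj hij (C := C)
          (P := bigVertices C k) (Q := ∅) (Wi := enclosed C k i (bigVertices C k)) (Wj := ∅)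
          hbig (by simp) (by simp) (by simp) (subset_refl _) (Set.empty_subset _)
          (isAcyclic_inside_union_class hR.2 hbig hi)
          (by simpa using isAcyclic_inside_class C j)
        exact ⟨S, T, h, h1 haB, h3 b hb hbe, h1 hcB⟩

theorem exists_containing_iki (hR : R.IsPlaneTriangulation) (hki : k ≠ i) (hkj : k ≠ j)
    (hij : i ≠ j) (hj : (G.inside (bigVertices C k ∪ bigVertices C j)).IsAcyclic)
    (ha : C a = i) (hb : C b = k) (hc : C c = i) :
    ∃ S T, IsTreePartition G S T ∧ a ∈ S ∧ b ∈ S ∧ c ∈ S := by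
  obtain ⟨S, T, h, h1, h2, -, -⟩ := hR.exists_star hki hkj hij hj hb
  exact ⟨S, T, h, h2 a ha, h1, h2 c hc⟩

end RotationSystem

open RotationSystem in
theorem theorem2p1 {V : Type*} [Fintype V] (G : SimpleGraph V) [DecidableRel G.Adj]
    (R : RotationSystem G) (hR : R.IsPlaneTriangulation)
    (heven : ∀ v : V, Even (G.degree v))
    (C : G.Coloring (Fin 3))
    (h12 : (G.induce (bigVertices C 0 ∪ bigVertices C 1)).IsAcyclic)
    (h13 : (G.induce (bigVertices C 0 ∪ bigVertices C 2)).IsAcyclic) :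
    (∀ a b c : V, G.Adj a b → G.Adj b c → a ≠ c →
      ∃ S T : Set V, IsTreePartition G S T ∧ a ∈ S ∧ b ∈ S ∧ c ∉ S) ∧
    (∀ a b c : V, G.Adj a b → G.Adj b c → a ≠ c → C a = C c →
      ∃ S T : Set V, IsTreePartition G S T ∧ a ∈ S ∧ b ∈ S ∧ c ∈ S) := by
  by_cases h2 : R.NoDegreeTwo
  swap
  · unfold NoDegreeTwo at h2
    push Not at h2
    obtain ⟨v, x, y, hvx, hvy⟩ := h2
    have hV := hvx.eq_or_of_follows hR.1.1 hR.2 hvy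
    have e1 := hvx.adj_left
    have e2 := hvx.adj_right
    have e3 := hvx.adj hR.2
    refine ⟨fun a b c hab hbc hac => exists_separating_of_triangle hR C ?_ hab.ne hac hbc.ne,
      fun a b c _ _ hac hC => ?_⟩
    · intro w
      have := hV w; have := hV a; have := hV b; have := hV c
      have := hab.ne; have := hbc.ne
      grind
    · have hadj : G.Adj a c := by
        rcases hV a with rfl | rfl | rfl <;> rcases hV c with rfl | rfl | rfl <;>
          first
          | exact absurd rfl hac
          | assumption
          | exact SimpleGraph.Adj.symm (by assumption)
      exact absurd hC (C.valid hadj)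
  rw [← SimpleGraph.isAcyclic_inside_iff] at h12 h13
  have n01 : (0 : Fin 3) ≠ 1 := by decide
  have n02 : (0 : Fin 3) ≠ 2 := by decide
  have n12 : (1 : Fin 3) ≠ 2 := by decide
  have h21 : (G.inside (bigVertices C 1 ∪ bigVertices C 0)).IsAcyclic := by
    rwa [Set.union_comm]
  have h31 : (G.inside (bigVertices C 2 ∪ bigVertices C 0)).IsAcyclic := by
    rwa [Set.union_comm]
  constructor
  · intro a b c hab hbc hac
    have hCab := C.valid hab
    have hCbc := C.valid hbc
    rcases fin_three_eq n01 n02 n12 (C a) with ha | ha | ha <;>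
      rcases fin_three_eq n01 n02 n12 (C b) with hb | hb | hb <;>
      rcases fin_three_eq n01 n02 n12 (C c) with hc | hc | hc
    all_goals first
      | exact absurd (ha.trans hb.symm) hCab
      | exact absurd (hb.trans hc.symm) hCbc
      | skip
    · exact exists_separating_kik hR h2 n01 n02 n12 h12 h13 ha hb hc hab hbc hac
    · exact exists_separating_kij hR h2 n01 n02 n12 h12 h13 ha hb hc hab hbc
    · exact exists_separating_kik hR h2 n02 n01 n12.symm h13 h12 ha hb hc hab hbc hac
    · exact exists_separating_kij hR h2 n02 n01 n12.symm h13 h12 ha hb hc hab hbc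
    · exact exists_separating_iki hR h2 n01 n02 n12 h12 h13 ha hb hc hab hbc hac
    · exact exists_separating_ikj hR n01 n02 n12 h13 ha hb hc hbc
    · exact exists_separating_ikj hR n12.symm n02.symm n01.symm h31 ha hb hc hbc
    · exact exists_separating_iji hR h2 n01 n02 n12 h12 h13 ha hb hc hbc hac
    · exact exists_separating_ikj hR n02 n01 n12.symm h12 ha hb hc hbc
    · exact exists_separating_iki hR h2 n02 n01 n12.symm h13 h12 ha hb hc hab hbc hac
    · exact exists_separating_ikj hR n12 n01.symm n02.symm h21 ha hb hc hbc
    · exact exists_separating_iji hR h2 n02 n01 n12.symm h13 h12 ha hb hc hbc hac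
  · intro a b c hab hbc _ hC
    have hCab := C.valid hab
    rcases fin_three_eq n01 n02 n12 (C a) with ha | ha | ha <;>
      rcases fin_three_eq n01 n02 n12 (C b) with hb | hb | hb
    all_goals first
      | exact absurd (ha.trans hb.symm) hCab
      | have hc := hC.symm.trans ha
    · exact exists_containing_kik hR h2 n01 n02 n12 h12 h13 ha hb hc hab hbc
    · exact exists_containing_kik hR h2 n02 n01 n12.symm h13 h12 ha hb hc hab hbc
    · exact exists_containing_iki hR n01 n02 n12 h13 ha hb hc
    · exact exists_containing_iki hR n12.symm n02.symm n01.symm h31 ha hb hc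
    · exact exists_containing_iki hR n02 n01 n12.symm h12 ha hb hc
    · exact exists_containing_iki hR n12 n01.symm n02.symm h21 ha hb hc
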